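/- Let $(R,\mathfrak m)$ be a (Noetherian) Cohen--Macaulay local ring of dimension $d>0$, let $I$ be an $\mathfrak m$-primary ideal, and let $J=(a_1,\dots,a_d)$ be a minimal reduction of $I$ generated by $d$ elements (if $R/\mathfrak m$ is infinite, every minimal reduction of $I$ is of this form). Put $I^i=0$ for $i<0$, let $\mathcal R(I)=\bigoplus_{n\ge0}I^nt^n$, let $Jt\,\mathcal R(I)$ be the ideal of $\mathcal R(I)$ generated by $Jt$, and consider $$C^{I,J}=\frac{\mathcal R(I)}{Jt\,\mathcal R(I)}[T_1,\dots,T_d],\qquad G=gr_{Jt}(\mathcal R(I))=\bigoplus_{j\ge0}\frac{(Jt\,\mathcal R(I))^j}{(Jt\,\mathcal R(I))^{j+1}}\,U^j ,$$ bigraded by $\deg (xt^k)=(k,0)$ for $x\in I^k$ and $\deg T_i=(1,1)$ on $C^{I,J}$, and such that the class of $xt^mU^n$ with $xt^m\in (Jt\,\mathcal R(I))^n$ has bidegree $(m,n)$ on $G$. Let $\pi:C^{I,J}\to G$ be the surjective bigraded ring homomorphism that is the inclusion of the $U^0$-part on $\mathcal R(I)/Jt\,\mathcal R(I)$ and satisfies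 $\pi(T_i)=a_itU$. For a bigraded $N$ let $N_{[p]}=\bigoplus_{m-n=p+1}N_{(m,n)}$, and set $$\mathcal M^{I,J}=\bigoplus_{p\ge0}C^{I,J}_{[p]},\qquad \Sigma^{I,J}=\bigoplus_{p\ge0}G_{[p]},\qquad K^{I,J}=\bigoplus_{p\ge0}(\ker\pi)_{[p]} .$$ For $N$ one of these three modules let $h_N(m,n)=\sum_{0\le j\le n}\mathrm{length}_R\,N_{(m,j)}$. Let $\Lambda(I,J)=\sum_{p\ge0}\mathrm{length}_R(I^{p+1}/JI^p)$. Let $e_0(I),\dots,e_d(I)\in\mathbb Z$ be the Hilbert coefficients of $I$, i.e. $$\sum_{j=0}^n\mathrm{length}_R(I^j/I^{j+1})=\sum_{j=0}^d(-1)^je_j(I)\binom{n+d-j}{d-j}\qquad\text{for } n\gg0,$$ and let $\delta(I,J)=\Lambda(I,J)-e_1(I)$. Then the integers $e_j(I)$ exist, $\Lambda(I,J)$ is finite, and for each $N\in\{\mathcal M^{I,J},\Sigma^{I,J},K^{I,J}\}$ there are a polynomial $p_N\in\mathbb Q[X]$ and integers $m_0,n_0\ge 0$ with $h_N(m,n)=p_N(m)$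 (in particular finite) for all $m\ge m_0$, $n\ge m+n_0$. Write $e_0(N)$ for $(\deg p_N)!$ times the leading coefficient of $p_N$, with $e_0(N)=0$ if $p_N=0$. The following hold. (i) If $\mathcal M^{I,J}\ne0$ then $\deg p_{\mathcal M^{I,J}}=d-1$; in all cases $e_0(\mathcal M^{I,J})=\Lambda(I,J)$. (ii) If $\Sigma^{I,J}=0$ then the associated graded ring $gr_I(R)=\bigoplus_{n\ge0}I^n/I^{n+1}$ is Cohen--Macaulay. If $\Sigma^{I,J}\ne0$ then $\deg p_{\Sigma^{I,J}}=d-1$ and $e_0(\Sigma^{I,J})=e_1(I)$. (iii) $e_0(K^{I,J})=\delta(I,J)$; if $K^{I,J}\ne0$ then $\deg p_{K^{I,J}}=d-1$. In particular $\Lambda(I,J)\ge e_1(I)$. -/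

import Mathlib

open Polynomial

/-- A local ring is Cohen-Macaulay if it is Noetherian and its maximal ideal contains a regular
sequence whose length is the Krull dimension. -/
def IsCohenMacaulayLocalRing (S : Type*) [CommRing S] [IsLocalRing S] : Prop :=
  IsNoetherianRing S ∧ ∃ rs : List S, (∀ x ∈ rs, x ∈ IsLocalRing.maximalIdeal S) ∧
    RingTheory.Sequence.IsRegular S rs ∧ ringKrullDim S = (rs.length : ℕ)

/-- A ring is Cohen-Macaulay if it is Noetherian and its localization at every maximal ideal is a
Cohen-Macaulay local ring. -/
def IsCohenMacaulayRing (S : Type*) [CommRing S] : Prop :=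
  IsNoetherianRing S ∧
    ∀ (P : Ideal S) [P.IsMaximal], IsCohenMacaulayLocalRing (Localization.AtPrime P)

/-- `J ⊆ I` is a reduction of `I` if `I ^ (r + 1) = J * I ^ r` for some `r`. -/
def IsReduction {R : Type*} [CommRing R] (J I : Ideal R) : Prop :=
  J ≤ I ∧ ∃ r : ℕ, I ^ (r + 1) = J * I ^ r

/-- A reduction of `I` that is minimal with respect to inclusion. -/
def IsMinimalReduction {R : Type*} [CommRing R] (J I : Ideal R) : Prop :=
  IsReduction J I ∧ ∀ K : Ideal R, K ≤ J → IsReduction K I → K = J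

/-- The length of `N / (N ∩ L)`; it is only used for `L ≤ N`, where it is the length of `N / L`. -/
noncomputable def quotLength {R : Type*} [CommRing R] (N L : Ideal R) : ℕ∞ :=
  Module.length R (N ⧸ L.submoduleOf N)

/-- `Λ(I, J) = ∑_{p ≥ 0} length (I ^ (p + 1) / J I ^ p)`, as the supremum of its partial sums. -/
noncomputable def lambdaInv {R : Type*} [CommRing R] (I J : Ideal R) : ℕ∞ :=
  ⨆ N : ℕ, ∑ p ∈ Finset.range N, quotLength (I ^ (p + 1)) (J * I ^ p)

/-- The Hilbert functions of `I`: `h⁰(n) = length (I ^ n / I ^ (n + 1))` and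
`hⁱ⁺¹(n) = ∑_{j ≤ n} hⁱ(j)`. -/
noncomputable def hilbertFun {R : Type*} [CommRing R] (I : Ideal R) : ℕ → ℕ → ℕ∞
  | 0, n => quotLength (I ^ n) (I ^ (n + 1))
  | i + 1, n => ∑ j ∈ Finset.range (n + 1), hilbertFun I i j

/-- `e 0, …, e d` are the Hilbert coefficients `e_0(I), …, e_d(I)` of `I`:
`h¹(n) = ∑_{j = 0}^{d} (-1)^j e_j binom(n + d - j, d - j)` for all large `n`.
This determines `e j` for all `j ≤ d`. -/
def IsHilbertCoeffs {R : Type*} [CommRing R] (I : Ideal R) (d : ℕ) (e : ℕ → ℤ) : Prop :=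
  ∃ n₀ : ℕ, ∀ n : ℕ, n₀ ≤ n → ∃ k : ℕ, hilbertFun I 1 n = (k : ℕ∞) ∧
    (k : ℤ) = ∑ j ∈ Finset.range (d + 1), (-1) ^ j * e j * ((n + (d - j)).choose (d - j) : ℤ)

/-- The associated graded ring `⨁ Qⁿ / Qⁿ⁺¹` of a ring `S` with respect to an ideal `Q`, as the
quotient of the Rees algebra `⨁ Qⁿ Uⁿ` by the ideal `⨁ Qⁿ⁺¹ Uⁿ` that `Q` generates in it. -/
abbrev AssocGr {S : Type*} [CommRing S] (Q : Ideal S) : Type _ :=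
  reesAlgebra Q ⧸ Q.map (algebraMap S (reesAlgebra Q))

namespace BigradedSally

variable {R : Type*} [CommRing R]

/-- The element `x tⁿ` of the Rees algebra, for `x ∈ I ^ n`. -/
noncomputable def homog {S : Type*} [CommRing S] (I : Ideal S) (n : ℕ) (x : S) (hx : x ∈ I ^ n) :
    reesAlgebra I :=
  ⟨monomial n x, reesAlgebra.monomial_mem.mpr hx⟩

/-- The ideal `J t ℛ(I)` of the Rees algebra `ℛ(I)`. -/
noncomputable def Jt (I J : Ideal R) (hJI : J ≤ I) : Ideal (reesAlgebra I) :=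
  Ideal.span {x | ∃ (c : R) (hc : c ∈ J), x = homog I 1 c (by simpa using hJI hc)}

/-- `gr_{Jt}(ℛ(I))`. -/
abbrev Gr (I J : Ideal R) (hJI : J ≤ I) : Type _ := AssocGr (Jt I J hJI)

noncomputable instance instCommRingReesQuot (I J : Ideal R) (hJI : J ≤ I) :
    CommRing (reesAlgebra I ⧸ Jt I J hJI) :=
  Ideal.Quotient.commRing _

/-- `C^{I,J} = (ℛ(I) / J t ℛ(I))[T_1, …, T_d]`. -/
abbrev C (I J : Ideal R) (hJI : J ≤ I) (d : ℕ) : Type _ :=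
  MvPolynomial (Fin d) (reesAlgebra I ⧸ Jt I J hJI)

/-- The class of `y Uⁿ` in `gr_{Jt}(ℛ(I))`, for `y ∈ (J t ℛ(I)) ^ n`. -/
noncomputable def grHomog (I J : Ideal R) (hJI : J ≤ I) (n : ℕ) (y : reesAlgebra I)
    (hy : y ∈ Jt I J hJI ^ n) : Gr I J hJI :=
  Ideal.Quotient.mk _ (homog (Jt I J hJI) n y hy)

/-- The bidegree `(m, n)` piece of `gr_{Jt}(ℛ(I))`: the classes of `x t^m U^n`, where
`x t^m` lies in `(J t ℛ(I)) ^ n`. -/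
noncomputable def grPiece (I J : Ideal R) (hJI : J ≤ I) (m n : ℕ) : Submodule R (Gr I J hJI) :=
  Submodule.span R {g | ∃ (x : R) (hx : x ∈ I ^ m) (hy : homog I m x hx ∈ Jt I J hJI ^ n),
    g = grHomog I J hJI n (homog I m x hx) hy}

/-- The bidegree `(m, n)` piece of `C^{I,J}`: it is spanned by the `c · T^s` with `|s| = n` and
`c` the class of some `x t^k`, `k + n = m`. -/
noncomputable def cPiece (I J : Ideal R) (hJI : J ≤ I) (d m n : ℕ) : Submodule R (C I J hJI d) :=
  Submodule.span R {f | ∃ (s : Fin d →₀ ℕ) (k : ℕ) (x : R) (hx : x ∈ I ^ k),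
    s.degree = n ∧ k + n = m ∧
      f = MvPolynomial.monomial s (Ideal.Quotient.mk (Jt I J hJI) (homog I k x hx))}

/-- The inclusion of the degree zero part `ℛ(I) / J t ℛ(I)` into `gr_{Jt}(ℛ(I))`. -/
noncomputable def toGr (I J : Ideal R) (hJI : J ≤ I) :
    (reesAlgebra I ⧸ Jt I J hJI) →+* Gr I J hJI :=
  Ideal.Quotient.lift (Jt I J hJI)
    ((Ideal.Quotient.mk _).comp (algebraMap (reesAlgebra I) (reesAlgebra (Jt I J hJI))))
    (fun _ hy => Ideal.Quotient.eq_zero_iff_mem.mpr (Ideal.mem_map_of_mem _ hy))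

theorem homog_one_mem_Jt (I J : Ideal R) (hJI : J ≤ I) (c : R) (hc : c ∈ J) :
    homog I 1 c (by simpa using hJI hc) ∈ Jt I J hJI ^ 1 := by
  rw [pow_one]
  exact Ideal.subset_span ⟨c, hc, rfl⟩

/-- The surjection `π : C^{I,J} → gr_{Jt}(ℛ(I))` with `π(T_i) = a_i t U`. -/
noncomputable def piMap (I J : Ideal R) (hJI : J ≤ I) {d : ℕ} (a : Fin d → R)
    (ha : ∀ i, a i ∈ J) : C I J hJI d →+* Gr I J hJI :=
  MvPolynomial.eval₂Hom (toGr I J hJI)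
    (fun i => grHomog I J hJI 1 (homog I 1 (a i) (by simpa using hJI (ha i)))
      (homog_one_mem_Jt I J hJI (a i) (ha i)))

/-- `⨁_{p ≥ 0} N_[p]`, where `N_[p]` is the direct sum of the pieces `N ∩ X_(m,n)` with
`m - n = p + 1`, for a bigraded submodule `N` of `X = ⨁ X_(m,n)`. -/
def diagPart {X : Type*} [AddCommMonoid X] [Module R X] (G : ℕ → ℕ → Submodule R X)
    (N : Submodule R X) : Submodule R X :=
  ⨆ p : ℕ, ⨆ n : ℕ, N ⊓ G (n + p + 1) n

/-- `Σ^{I,J}`, the bigraded Sally module. -/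
noncomputable def sigmaMod (I J : Ideal R) (hJI : J ≤ I) : Submodule R (Gr I J hJI) :=
  diagPart (grPiece I J hJI) ⊤

/-- `ℳ^{I,J}`. -/
noncomputable def mMod (I J : Ideal R) (hJI : J ≤ I) (d : ℕ) : Submodule R (C I J hJI d) :=
  diagPart (cPiece I J hJI d) ⊤

/-- `K^{I,J}`, the part of the kernel of `π` in the diagonals `p ≥ 0`. -/
noncomputable def kMod (I J : Ideal R) (hJI : J ≤ I) {d : ℕ} (a : Fin d → R)
    (ha : ∀ i, a i ∈ J) : Submodule R (C I J hJI d) :=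
  diagPart (cPiece I J hJI d) ((RingHom.ker (piMap I J hJI a ha)).restrictScalars R)

/-- The Hilbert function `h_N(m, n) = ∑_{0 ≤ j ≤ n} length N_(m,j)` of a bigraded submodule `N`
of `X = ⨁ X_(m,n)`. For a module over `A = (R/J)[V; T]` the length of a piece over `R` is its
length over `R/J`, the bidegree `(0, 0)` part of `A`. -/
noncomputable def bigradedHilbert {X : Type*} [CommRing X] [Algebra R X]
    (G : ℕ → ℕ → Submodule R X) (N : Submodule R X) (m n : ℕ) : ℕ∞ :=
  ∑ j ∈ Finset.range (n + 1), Module.length R (N ⊓ G m j : Submodule R X)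

/-- The Hilbert function of `Σ^{I,J}`. -/
noncomputable def hilbertSigma (I J : Ideal R) (hJI : J ≤ I) : ℕ → ℕ → ℕ∞ :=
  bigradedHilbert (R := R) (X := Gr I J hJI) (grPiece I J hJI) (sigmaMod I J hJI)

/-- The Hilbert function of `ℳ^{I,J}`. -/
noncomputable def hilbertM (I J : Ideal R) (hJI : J ≤ I) (d : ℕ) : ℕ → ℕ → ℕ∞ :=
  bigradedHilbert (R := R) (X := C I J hJI d) (cPiece I J hJI d) (mMod I J hJI d)

/-- The Hilbert function of `K^{I,J}`. -/
noncomputable def hilbertK (I J : Ideal R) (hJI : J ≤ I) {d : ℕ} (a : Fin d → R)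
    (ha : ∀ i, a i ∈ J) : ℕ → ℕ → ℕ∞ :=
  bigradedHilbert (R := R) (X := C I J hJI d) (cPiece I J hJI d) (kMod I J hJI a ha)

/-- `h` is finite and given by the polynomial `p` in the first variable, in the range
`m ≥ m₀`, `n ≥ m + n₀`. Such a `p` is unique. -/
def IsHilbertPoly (h : ℕ → ℕ → ℕ∞) (p : ℚ[X]) : Prop :=
  ∃ m₀ n₀ : ℕ, ∀ m n : ℕ, m₀ ≤ m → m + n₀ ≤ n →
    ∃ k : ℕ, h m n = (k : ℕ∞) ∧ p.eval (m : ℚ) = (k : ℚ)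

/-- The multiplicity `e_0` read off from a Hilbert polynomial: the leading coefficient times the
factorial of the degree (and `0` for the zero polynomial). -/
noncomputable def multiplicity (p : ℚ[X]) : ℚ := (p.natDegree.factorial : ℚ) * p.leadingCoeff

end BigradedSally

/-! Everything reduces to three length functions on the range $n\ge m$, where the Hilbert functions
no longer depend on $n$. The ideal $(Jt)^j$ has degree $m$ part $J^jI^{m-j}$, so the lengths of the
pieces of $\Sigma$ telescope and $h_\Sigma=\mathrm{length}(I^m/J^m)$ (`hilbertSigma_eq`). Counting
monomials gives $h_{\mathcal M}=\sum_p\binom{m-p-1+d-1}{d-1}\mathrm{length}(I^{p+1}/JI^p)$, a finite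
sum because $J$ is a reduction (`hilbertM_eq_sum`). Since $\pi$ is onto in each bidegree,
$h_K=h_{\mathcal M}-h_\Sigma$ (`hilbertM_eq_add`). The coefficient of $X^{d-1}$ in $p_{\mathcal M}$
is therefore $\Lambda/(d-1)!$.

The Cohen-Macaulay hypothesis enters through quasi-regularity: the generators of $J$ are a system of
parameters, hence a regular sequence, so each $J^n/J^{n+1}$ is free over $R/J$ on the monomials of
degree $n$ (`IsQuasiRegular.quotLength_mul_pow`). Thus
$\mathrm{length}(R/J^{n+1})=\mathrm{length}(R/J)\binom{n+d}{d}$. Subtracting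
$\mathrm{length}(I^{n+1}/J^{n+1})$, which Hilbert-Serre makes polynomial of degree less than $d$
(`eventuallyPoly_quotLength_pow`), yields all the $e_j(I)$ and identifies $e_1(I)/(d-1)!$ as the
coefficient of $X^{d-1}$ in $p_\Sigma$.

It remains to see that these coefficients are positive when the modules are nonzero. For $\Sigma$,
$I^{m+1}/J^{m+1}$ contains $IJ^m/J^{m+1}$, which is $I/J$ repeated once per monomial
(`choose_le_hilbertSigma`). For $K$, a nonzero homogeneous element has a nonzero multiple killed by
$\mathfrak m$, and this multiple spans a free module over a polynomial ring in $d$ variables over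
the residue field (`exists_choose_le_hilbertK`). Finally $\Sigma=0$ means $I=J$, and then
$gr_I(R)\cong(R/J)[T_1,\dots,T_d]$ with $R/J$ Artinian
(`IsQuasiRegular.isCohenMacaulayRing_assocGr`). -/

/-! ### Depth, dimension and systems of parameters -/

open RingTheory.Sequence Module in
-- Let $N$ be the submodule of $M$ killed by $P$. If $N\subseteq xM$, regularity of $x$ gives
-- $N=xN$, so $N=0$ by Nakayama, which is impossible. Hence some element of $N$ has nonzero class in
-- $M/xM$; its annihilator contains $P$ and $x$ and lies in an associated prime.
theorem exists_mem_associatedPrimes_quotSMulTop {R M : Type*} [CommRing R] [IsNoetherianRing R]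
    [IsLocalRing R] [AddCommGroup M] [Module R M] [Module.Finite R M] {x : R}
    (hxm : x ∈ IsLocalRing.maximalIdeal R) (hx : IsSMulRegular M x) {P : Ideal R}
    (hP : P ∈ associatedPrimes R M) :
    ∃ Q ∈ associatedPrimes R (QuotSMulTop x M), P ≤ Q ∧ x ∈ Q := by
  obtain ⟨hPp, m₀, hm₀⟩ := isAssociatedPrime_iff.mp hP
  set N : Submodule R M := Submodule.torsionBySet R M (P : Set R) with hN
  have hm₀N : m₀ ∈ N := by
    rw [hN, Submodule.mem_torsionBySet_iff]
    rintro ⟨a, ha⟩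
    have : a ∈ P := ha
    rw [hm₀, Submodule.mem_colon_singleton] at this
    simpa using this
  have hm₀0 : m₀ ≠ 0 := by
    rintro rfl
    apply hPp.ne_top
    rw [hm₀, Ideal.eq_top_iff_one, Submodule.mem_colon_singleton]
    simp
  have hnot : ¬ N ≤ Ideal.span {x} • (⊤ : Submodule R M) := by
    intro hle
    apply hm₀0
    have : N = ⊥ := by
      apply Submodule.eq_bot_of_le_smul_of_le_jacobson_bot (Ideal.span {x}) N
        (IsNoetherian.noetherian _)
      · intro m hm
        have h1 := hle hm
        rw [Submodule.ideal_span_singleton_smul] at h1 ⊢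
        obtain ⟨m', -, rfl⟩ := (Submodule.mem_smul_pointwise_iff_exists _ _ _).mp h1
        refine (Submodule.mem_smul_pointwise_iff_exists _ _ _).mpr ⟨m', ?_, rfl⟩
        rw [hN, Submodule.mem_torsionBySet_iff] at hm ⊢
        intro a
        apply hx
        have := hm a
        simp only [smul_zero]
        rw [smul_comm]
        exact this
      · rw [Ideal.span_le, Set.singleton_subset_iff]
        exact IsLocalRing.maximalIdeal_le_jacobson _ hxm
    rw [this] at hm₀N
    simpa using hm₀N
  obtain ⟨m, hmN, hm⟩ := SetLike.not_le_iff_exists.mp hnot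
  rw [Submodule.ideal_span_singleton_smul] at hm
  have hm' : (Submodule.Quotient.mk m : QuotSMulTop x M) ≠ 0 := by
    rwa [Ne, Submodule.Quotient.mk_eq_zero]
  obtain ⟨Q, hQ, hle⟩ := exists_le_isAssociatedPrime_of_isNoetherianRing R _ hm'
  refine ⟨Q, hQ, fun a ha => hle ?_, hle ?_⟩
  · rw [Submodule.mem_colon_singleton, ← Submodule.Quotient.mk_smul]
    rw [hN, Submodule.mem_torsionBySet_iff] at hmN
    have : a • m = 0 := hmN ⟨a, ha⟩
    simp [this]
  · rw [Submodule.mem_colon_singleton, ← Submodule.Quotient.mk_smul, Submodule.mem_bot,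
      Submodule.Quotient.mk_eq_zero]
    exact Submodule.smul_mem_pointwise_smul _ _ _ trivial

open RingTheory.Sequence in
-- Depth bounds $\dim R/P$ for every associated prime $P$. In the induction $P$ is enlarged to an
-- associated prime $Q\ni x$ of $M/xM$; as $x\notin P$ is a nonzerodivisor on $R/P$, the dimension
-- drops by at least one.
theorem length_le_ringKrullDim_quotient_of_mem_associatedPrimes {R : Type*} [CommRing R]
    [IsNoetherianRing R] [IsLocalRing R] (rs : List R)
    (hmem : ∀ r ∈ rs, r ∈ IsLocalRing.maximalIdeal R) {M : Type*} [AddCommGroup M] [Module R M]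
    [Module.Finite R M] (hrs : IsWeaklyRegular M rs) {P : Ideal R}
    (hP : P ∈ associatedPrimes R M) : ((rs.length : ℕ) : WithBot ℕ∞) ≤ ringKrullDim (R ⧸ P) := by
  induction rs generalizing M P with
  | nil =>
    have := IsAssociatedPrime.isPrime hP
    simpa using ringKrullDim_nonneg_of_nontrivial
  | cons x rs ih =>
    rw [isWeaklyRegular_cons_iff] at hrs
    have hxm := hmem x List.mem_cons_self
    obtain ⟨Q, hQ, hPQ, hxQ⟩ := exists_mem_associatedPrimes_quotSMulTop hxm hrs.1 hP
    have h1 := ih (fun r hr => hmem r (List.mem_cons_of_mem _ hr)) hrs.2 hQ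
    have hPp := IsAssociatedPrime.isPrime hP
    have hxP : x ∉ P := by
      intro hxP
      obtain ⟨hPp, m₀, hm₀⟩ := isAssociatedPrime_iff.mp hP
      have hxm : x • m₀ = 0 := by
        rw [hm₀, Submodule.mem_colon_singleton] at hxP
        simpa using hxP
      have : m₀ = 0 := hrs.1 (by simpa using hxm)
      apply hPp.ne_top
      rw [hm₀, Ideal.eq_top_iff_one, Submodule.mem_colon_singleton]
      simp [this]
    have hx0 : Ideal.Quotient.mk P x ≠ 0 := by rwa [Ne, Ideal.Quotient.eq_zero_iff_mem]
    have h2 := ringKrullDim_quotient_succ_le_of_nonZeroDivisor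
      (mem_nonZeroDivisors_of_ne_zero hx0)
    have h3 : ringKrullDim (R ⧸ Q) ≤
        ringKrullDim ((R ⧸ P) ⧸ Ideal.span {Ideal.Quotient.mk P x}) := by
      refine ringKrullDim_le_of_surjective (Ideal.Quotient.lift _ (Ideal.Quotient.factor hPQ) ?_) ?_
      · intro a ha
        obtain ⟨b, rfl⟩ := Ideal.mem_span_singleton'.mp ha
        rw [map_mul, Ideal.Quotient.factor_mk, Ideal.Quotient.eq_zero_iff_mem.mpr hxQ, mul_zero]
      · exact Ideal.Quotient.lift_surjective_of_surjective _ _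
          (Ideal.Quotient.factor_surjective hPQ)
    calc (((x :: rs).length : ℕ) : WithBot ℕ∞) = ((rs.length : ℕ) : WithBot ℕ∞) + 1 := by simp
      _ ≤ ringKrullDim (R ⧸ Q) + 1 := by gcongr
      _ ≤ ringKrullDim ((R ⧸ P) ⧸ Ideal.span {Ideal.Quotient.mk P x}) + 1 := by gcongr
      _ ≤ _ := h2

theorem span_singleton_sup_annihilator_le {R M : Type*} [CommRing R] [AddCommGroup M]
    [Module R M] (x : R) :
    Ideal.span {x} ⊔ Module.annihilator R M ≤ Module.annihilator R (QuotSMulTop x M) := by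
  apply sup_le
  · rw [Ideal.span_le, Set.singleton_subset_iff, SetLike.mem_coe, Module.mem_annihilator]
    intro m
    obtain ⟨m, rfl⟩ := Submodule.Quotient.mk_surjective _ m
    rw [← Submodule.Quotient.mk_smul, Submodule.Quotient.mk_eq_zero]
    exact Submodule.smul_mem_pointwise_smul _ _ _ trivial
  · exact LinearMap.annihilator_le_of_surjective _ (Submodule.mkQ_surjective _)

/-- Killing one element lowers the dimension of the support by at most one, and at the end the
support contains at most the maximal ideal. -/
theorem supportDim_le_length {R : Type*} [CommRing R] [IsNoetherianRing R] [IsLocalRing R]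
    (t : List R) (hmem : ∀ r ∈ t, r ∈ IsLocalRing.maximalIdeal R)
    {M : Type*} [AddCommGroup M] [Module R M] [Module.Finite R M]
    (h : IsLocalRing.maximalIdeal R ≤ (Ideal.ofList t ⊔ Module.annihilator R M).radical) :
    Module.supportDim R M ≤ ((t.length : ℕ) : WithBot ℕ∞) := by
  induction t generalizing M with
  | nil =>
    simp only [Ideal.ofList_nil, bot_sup_eq] at h
    have : Subsingleton (Module.support R M) := by
      have key : ∀ p ∈ Module.support R M, p.asIdeal = IsLocalRing.maximalIdeal R := by
        intro p hp
        rw [Module.mem_support_iff_of_finite] at hp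
        exact le_antisymm (IsLocalRing.le_maximalIdeal p.2.ne_top)
          (h.trans ((Ideal.radical_mono hp).trans p.2.radical.le))
      exact ⟨fun p q => Subtype.ext (PrimeSpectrum.ext ((key p p.2).trans (key q q.2).symm))⟩
    simpa using! Order.krullDim_nonpos_of_subsingleton
  | cons x t ih =>
    have h1 := Module.supportDim_le_supportDim_quotSMulTop_succ_of_mem_jacobson (M := M)
      (IsLocalRing.maximalIdeal_le_jacobson _ (hmem x List.mem_cons_self))
    have h2 := ih (fun r hr => hmem r (List.mem_cons_of_mem _ hr)) (M := QuotSMulTop x M) (by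
      refine h.trans (Ideal.radical_mono ?_)
      rw [Ideal.ofList_cons, sup_comm (Ideal.span {x}), sup_assoc]
      exact sup_le_sup_left (span_singleton_sup_annihilator_le x) _)
    calc _ ≤ _ := h1
      _ ≤ ((t.length : ℕ) : WithBot ℕ∞) + 1 := by gcongr
      _ = _ := by simp

open RingTheory.Sequence CategoryTheory Abelian Limits in
-- Depth is read off from the vanishing of Ext groups; the long exact sequence of multiplication by
-- $x$ costs one degree, so passing to $M/xM$ costs one element whichever regular $x$ is used.
theorem exists_isRegular_quotSMulTop.{u} {R : Type u} [CommRing R] [IsNoetherianRing R] [IsLocalRing R]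
    {M : Type u} [AddCommGroup M] [Module R M] [Module.Finite R M] {x : R}
    (hxm : x ∈ IsLocalRing.maximalIdeal R) (hx : IsSMulRegular M x) (rs : List R) {n : ℕ}
    (hn : rs.length = n + 1) (hmem : ∀ r ∈ rs, r ∈ IsLocalRing.maximalIdeal R)
    (hrs : IsRegular M rs) :
    ∃ rs' : List R, rs'.length = n ∧ (∀ r ∈ rs', r ∈ IsLocalRing.maximalIdeal R) ∧
      IsRegular (QuotSMulTop x M) rs' := by
  have hnt : Nontrivial M := hrs.nontrivial
  have hnt' : Nontrivial (QuotSMulTop x M) := nontrivial_quotSMulTop_of_mem_maximalIdeal M hxm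
  have key : ∀ (N : Type u) [AddCommGroup N] [Module R N] [Module.Finite R N] [Nontrivial N],
      IsLocalRing.maximalIdeal R • (⊤ : Submodule R N) < ⊤ := fun N _ _ _ _ =>
    (Submodule.top_ne_ideal_smul_of_le_jacobson_annihilator
      (IsLocalRing.maximalIdeal_le_jacobson _)).symm.lt_top
  have h3 := (ModuleCat.exists_isRegular_tfae (IsLocalRing.maximalIdeal R) (n + 1)
    (ModuleCat.of R M) (key M)).out 1 3
  have h4 := h3.mpr ⟨rs, hn, hmem, hrs⟩
  refine ((ModuleCat.exists_isRegular_tfae (IsLocalRing.maximalIdeal R) n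
    (ModuleCat.of R (QuotSMulTop x M)) (key _)).out 1 3).mp ?_
  intro i hi
  have zero1 := AddCommGrpCat.isZero_of_iff_subsingleton.mpr (h4 i (by omega))
  have zero2 := AddCommGrpCat.isZero_of_iff_subsingleton.mpr (h4 (i + 1) (by omega))
  exact AddCommGrpCat.subsingleton_of_isZero <| ShortComplex.Exact.isZero_of_both_zeros
    ((Ext.covariant_sequence_exact₃' _
      (IsSMulRegular.smulShortComplex_shortExact (M := ModuleCat.of R M) hx)) i (i + 1) rfl)
    (zero1.eq_zero_of_src _) (zero2.eq_zero_of_tgt _)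

open RingTheory.Sequence in
/-- In a Noetherian local ring, a sequence of `n` elements that is a system of parameters for a
module with depth at least `n` is weakly regular on that module. -/
theorem isWeaklyRegular_of_maximalIdeal_le_radical.{u} {R : Type u} [CommRing R] [IsNoetherianRing R]
    [IsLocalRing R] (t : List R) (hmem : ∀ r ∈ t, r ∈ IsLocalRing.maximalIdeal R)
    {M : Type u} [AddCommGroup M] [Module R M] [Module.Finite R M]
    (h : IsLocalRing.maximalIdeal R ≤ (Ideal.ofList t ⊔ Module.annihilator R M).radical)
    (rs : List R) (hn : rs.length = t.length)
    (hmem' : ∀ r ∈ rs, r ∈ IsLocalRing.maximalIdeal R) (hrs : IsRegular M rs) :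
    IsWeaklyRegular M t := by
  induction t generalizing M rs with
  | nil => exact IsWeaklyRegular.nil R M
  | cons x t ih =>
    have hxm := hmem x List.mem_cons_self
    have htm : ∀ r ∈ t, r ∈ IsLocalRing.maximalIdeal R :=
      fun r hr => hmem r (List.mem_cons_of_mem _ hr)
    have hx : IsSMulRegular M x := by
      -- If $x$ were a zero divisor it would lie in an associated prime $P$. The remaining
      -- parameters then suffice for $R/P$, so $\dim R/P$ is at most the length of `t`, while the
      -- depth forces one more.
      by_contra hx
      have hxc : x ∈ ({r | IsSMulRegular M r} : Set R)ᶜ := hx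
      rw [← biUnion_associatedPrimes_eq_compl_regular] at hxc
      simp only [Set.mem_iUnion] at hxc
      obtain ⟨P, hP, hxP⟩ := hxc
      have h1 := length_le_ringKrullDim_quotient_of_mem_associatedPrimes rs hmem'
        hrs.toIsWeaklyRegular hP
      have hann : Module.annihilator R M ≤ P := by
        obtain ⟨hPp, m₀, hm₀⟩ := isAssociatedPrime_iff.mp hP
        intro a ha
        rw [hm₀, Submodule.mem_colon_singleton, Module.mem_annihilator.mp ha]
        exact zero_mem _
      have h2 := supportDim_le_length t htm (M := R ⧸ P) (by
        refine h.trans (Ideal.radical_mono ?_)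
        rw [Ideal.annihilator_quotient, Ideal.ofList_cons]
        refine sup_le (sup_le ?_ le_sup_left) (hann.trans le_sup_right)
        rw [Ideal.span_le, Set.singleton_subset_iff]
        exact Ideal.mem_sup_right hxP)
      rw [Module.supportDim_quotient_eq_ringKrullDim] at h2
      have h3 := h1.trans h2
      rw [hn] at h3
      simp only [List.length_cons, Nat.cast_le] at h3
      have h4 : t.length + 1 ≤ t.length := by exact_mod_cast h3
      omega
    refine IsWeaklyRegular.cons hx ?_
    obtain ⟨rs', hn', hmem'', hrs'⟩ := exists_isRegular_quotSMulTop hxm hx rs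
      (n := t.length) (by simpa using hn) hmem' hrs
    refine ih htm ?_ rs' hn' hmem'' hrs'
    refine h.trans (Ideal.radical_mono ?_)
    rw [Ideal.ofList_cons, sup_comm (Ideal.span {x}), sup_assoc]
    exact sup_le_sup_left (span_singleton_sup_annihilator_le x) _

/-! ### Regular sequences are quasi-regular -/

namespace MvPolynomial

theorem eval_mem_mul_span_pow {R : Type*} [CommRing R] {σ : Type*} (a : σ → R) (K : Ideal R)
    {n : ℕ} {F : MvPolynomial σ R} (hF : F.IsHomogeneous n) (hK : ∀ s, F.coeff s ∈ K) :
    eval a F ∈ K * Ideal.span (Set.range a) ^ n := by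
  rw [eval_eq]
  refine Ideal.sum_mem _ fun s hs => Ideal.mul_mem_mul (hK s) ?_
  have hdeg : n = ∑ i ∈ s.support, s i := by
    have := hF (mem_support_iff.mp hs)
    rw [← this]
    simp [Finsupp.weight_apply, Finsupp.sum]
  rw [hdeg, ← Finset.prod_pow_eq_pow_sum]
  exact Ideal.prod_mem_prod fun i _ =>
    Ideal.pow_mem_pow (Ideal.subset_span (Set.mem_range_self i)) _

theorem exists_isHomogeneous_eval_eq_of_mem {R : Type*} [CommRing R] {σ : Type*} [Fintype σ]
    (a : σ → R) (K : Ideal R) (n : ℕ) {y : R} (hy : y ∈ K * Ideal.span (Set.range a) ^ n) :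
    ∃ F : MvPolynomial σ R, F.IsHomogeneous n ∧ (∀ s, F.coeff s ∈ K) ∧ eval a F = y := by
  -- As membership in an ideal, the condition on coefficients survives sums and products.
  suffices h : ∃ F : MvPolynomial σ R, F.IsHomogeneous n ∧ F ∈ Ideal.map C K ∧ eval a F = y by
    simpa only [mem_map_C_iff] using h
  induction n generalizing y with
  | zero =>
    rw [pow_zero, mul_one] at hy
    exact ⟨C y, isHomogeneous_C _ _, Ideal.mem_map_of_mem _ hy, eval_C _⟩
  | succ n ih =>
    rw [pow_succ, ← mul_assoc] at hy
    refine Submodule.mul_induction_on hy (fun x hx g hg => ?_) ?_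
    · obtain ⟨F, hF, hFK, rfl⟩ := ih hx
      obtain ⟨c, rfl⟩ := Ideal.mem_span_range_iff_exists_fun.mp hg
      refine ⟨F * ∑ i, C (c i) * X i, hF.mul ?_, Ideal.mul_mem_right _ _ hFK, by simp⟩
      refine IsHomogeneous.sum _ _ _ fun i _ => ?_
      simpa using (isHomogeneous_C σ (c i)).mul (isHomogeneous_X R i)
    · rintro _ _ ⟨F, hF, hFK, rfl⟩ ⟨G, hG, hGK, rfl⟩
      exact ⟨F + G, hF.add hG, Ideal.add_mem _ hFK hGK, by simp⟩

/-- The form of quasi-regularity that concerns polynomials vanishing at `a` implies the form that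
concerns the associated graded ring. -/
theorem coeff_mem_of_eval_mem_pow {R : Type*} [CommRing R] {σ : Type*} [Fintype σ]
    (a : σ → R) {n : ℕ}
    (h : ∀ F : MvPolynomial σ R, F.IsHomogeneous n → eval a F = 0 →
      ∀ s, F.coeff s ∈ Ideal.span (Set.range a))
    {F : MvPolynomial σ R} (hF : F.IsHomogeneous n)
    (h0 : eval a F ∈ Ideal.span (Set.range a) ^ (n + 1)) (s : σ →₀ ℕ) :
    F.coeff s ∈ Ideal.span (Set.range a) := by
  rw [pow_succ'] at h0
  -- A value in $J\cdot J^n$ is also the value of a form of degree $n$ with coefficients in $J$; the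
  -- difference vanishes at `a`.
  obtain ⟨G, hG, hGK, hGF⟩ := exists_isHomogeneous_eval_eq_of_mem a _ n h0
  have := h (F - G) (hF.sub hG) (by simp [hGF]) s
  rw [coeff_sub] at this
  simpa using Ideal.add_mem _ this (hGK s)

/-- A nonzerodivisor modulo the ideal stays one modulo its powers, because quasi-regularity controls
the coefficients of the form representing $y$: if $xF$ has value in the next power, its coefficients
lie in the ideal, and $x$ can be cancelled. -/
theorem mem_span_pow_of_mul_mem {R : Type*} [CommRing R] {σ : Type*} [Fintype σ]
    (a : σ → R)
    (h : ∀ n, ∀ F : MvPolynomial σ R, F.IsHomogeneous n → eval a F = 0 →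
      ∀ s, F.coeff s ∈ Ideal.span (Set.range a))
    {x : R} (hx : ∀ y, x * y ∈ Ideal.span (Set.range a) → y ∈ Ideal.span (Set.range a))
    (k : ℕ) {y : R} (hy : x * y ∈ Ideal.span (Set.range a) ^ k) :
    y ∈ Ideal.span (Set.range a) ^ k := by
  induction k generalizing y with
  | zero => simp
  | succ k ih =>
    have hy' : y ∈ ⊤ * Ideal.span (Set.range a) ^ k := by
      rw [Ideal.top_mul]
      exact ih (Ideal.pow_le_pow_right (Nat.le_succ k) hy)
    obtain ⟨F, hF, -, rfl⟩ := exists_isHomogeneous_eval_eq_of_mem a _ k hy'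
    have hxF : (C x * F).IsHomogeneous k := by
      simpa using (isHomogeneous_C σ x).mul hF
    rw [pow_succ']
    refine eval_mem_mul_span_pow a _ hF fun s => hx _ ?_
    have := coeff_mem_of_eval_mem_pow a (h k) hxF (by simpa using hy) s
    simpa using this

/-- A sequence in which every member is regular modulo the later ones is quasi-regular. -/
theorem coeff_mem_span_of_eval_eq_zero {R : Type*} [CommRing R] {d : ℕ} (a : Fin d → R)
    (ha : ∀ i : Fin d, ∀ y, a i * y ∈ Ideal.span (a '' Set.Ioi i) →
      y ∈ Ideal.span (a '' Set.Ioi i)) {n : ℕ} {F : MvPolynomial (Fin d) R}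
    (hF : F.IsHomogeneous n) (h0 : eval a F = 0) (s : Fin d →₀ ℕ) :
    F.coeff s ∈ Ideal.span (Set.range a) := by
  induction d generalizing n with
  | zero =>
    rw [eq_C_of_isEmpty F] at h0
    rw [eval_C] at h0
    rw [Subsingleton.elim s 0, h0]
    exact zero_mem _
  | succ d ih =>
    set b : Fin d → R := fun i => a i.succ with hb
    have hab : a = Fin.cons (a 0) b := by
      ext i
      refine Fin.cases ?_ (fun j => ?_) i <;> simp [hb]
    have hrange : Set.range b = a '' Set.Ioi 0 := by
      ext x
      simp only [Set.mem_range, Set.mem_image, Set.mem_Ioi, hb]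
      constructor
      · rintro ⟨i, rfl⟩
        exact ⟨i.succ, Fin.succ_pos i, rfl⟩
      · rintro ⟨i, hi, rfl⟩
        exact ⟨i.pred hi.ne', by simp⟩
    have hble : Ideal.span (Set.range b) ≤ Ideal.span (Set.range a) := by
      rw [hrange]
      exact Ideal.span_mono (Set.image_subset_range _ _)
    have ihb := fun {n} {F} => @ih b (by
      intro i y hy
      have himg : b '' Set.Ioi i = a '' Set.Ioi i.succ := by
        ext x
        simp only [Set.mem_image, Set.mem_Ioi, hb]
        constructor
        · rintro ⟨j, hj, rfl⟩
          exact ⟨j.succ, Fin.succ_lt_succ_iff.mpr hj, rfl⟩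
        · rintro ⟨j, hj, rfl⟩
          refine ⟨j.pred ((Fin.succ_pos i).trans hj).ne', ?_, by simp⟩
          rw [← Fin.succ_lt_succ_iff]
          simpa using hj
      rw [himg] at hy ⊢
      exact ha i.succ y hy) n F
    have hreg : ∀ y, a 0 * y ∈ Ideal.span (Set.range b) → y ∈ Ideal.span (Set.range b) := by
      rw [hrange]
      exact ha 0
    induction n generalizing F s with
    | zero =>
      rw [← totalDegree_zero_iff_isHomogeneous, totalDegree_eq_zero_iff_eq_C] at hF
      rw [hF, eval_C] at h0
      rw [hF, h0]
      simp
    | succ n ihn =>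
      set p := finSuccEquiv R d F with hp
      have hcoeff : ∀ (m : Fin d →₀ ℕ) i, coeff m (p.coeff i) = coeff (m.cons i) F :=
        fun m i => finSuccEquiv_coeff_coeff m F i
      -- Write $F=G+T_0H$ with $G$ free of $T_0$. The outer induction, on the number of variables,
      -- handles $G$; the inner one, on the degree, handles $H$.
      set H := (finSuccEquiv R d).symm p.divX with hH
      have hHc : ∀ (m : Fin d →₀ ℕ) i, coeff (m.cons i) H = coeff (m.cons (i + 1)) F := by
        intro m i
        rw [← finSuccEquiv_coeff_coeff, hH, AlgEquiv.apply_symm_apply, Polynomial.coeff_divX,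
          hcoeff]
      have hHhom : H.IsHomogeneous n := by
        intro m hm
        rw [← Finsupp.cons_tail m, hHc] at hm
        have := hF hm
        rw [← Finsupp.cons_tail m]
        rw [Finsupp.weight_apply, Finsupp.sum_fintype _ _ (by simp), Fin.sum_univ_succ] at this ⊢
        simp only [Finsupp.cons_zero, Finsupp.cons_succ, Pi.one_apply, smul_eq_mul,
          mul_one] at this ⊢
        omega
      have hG : (p.coeff 0).IsHomogeneous (n + 1) :=
        hF.finSuccEquiv_coeff_isHomogeneous 0 (n + 1) (by omega)
      have heval : eval a F = eval b (p.coeff 0) + a 0 * eval a H := by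
        conv_lhs => rw [hab, eval_eq_eval_mv_eval', ← hp, ← Polynomial.divX_mul_X_add p]
        conv_rhs => rw [hab, eval_eq_eval_mv_eval', hH, AlgEquiv.apply_symm_apply]
        simp
        ring
      have hmem : a 0 * eval a H ∈ Ideal.span (Set.range b) ^ (n + 1) := by
        have h1 : a 0 * eval a H = - eval b (p.coeff 0) := by
          rw [h0] at heval
          linear_combination -heval
        rw [h1, neg_mem_iff]
        simpa using eval_mem_mul_span_pow b ⊤ hG (fun _ => trivial)
      -- From $a_0H(a)=-G(b)\in(b)^{n+1}$, cancelling $a_0$ gives $H(a)\in(b)^{n+1}$. So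
      -- $H(a)=H'(b)$ with $H'$ of degree $n+1$, and $G+a_0H'$ vanishes at $b$.
      have hHmem := mem_span_pow_of_mul_mem b (fun n F hF h0 s => ihb hF h0 s) hreg _ hmem
      have hHcoeff : ∀ s, coeff s H ∈ Ideal.span (Set.range a) := fun s =>
        coeff_mem_of_eval_mem_pow a (fun F hF h0 s => ihn hF h0 s) hHhom
          (Ideal.pow_right_mono hble _ hHmem) s
      rw [← Ideal.top_mul (Ideal.span (Set.range b) ^ (n + 1))] at hHmem
      obtain ⟨H', hH', -, hHH'⟩ := exists_isHomogeneous_eval_eq_of_mem b _ _ hHmem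
      have hG' : (p.coeff 0 + C (a 0) * H').IsHomogeneous (n + 1) :=
        hG.add (by simpa using (isHomogeneous_C _ (a 0)).mul hH')
      have hGcoeff : ∀ s, coeff s (p.coeff 0) ∈ Ideal.span (Set.range a) := by
        intro s
        have h1 := hble (ihb hG' (by simp [hHH', ← heval, h0]) s)
        rw [coeff_add, coeff_C_mul] at h1
        have h2 : a 0 * coeff s H' ∈ Ideal.span (Set.range a) :=
          Ideal.mul_mem_right _ _ (Ideal.subset_span ⟨0, rfl⟩)
        simpa using Ideal.sub_mem _ h1 h2
      rw [← Finsupp.cons_tail s]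
      rcases h : s 0 with _ | k
      · rw [← hcoeff]
        exact hGcoeff _
      · rw [← hHc]
        exact hHcoeff _

end MvPolynomial

open RingTheory.Sequence in
-- In a Noetherian local ring a regular sequence may be permuted. Reversing it makes each member
-- regular modulo the later ones, the order suited to splitting off the variable with index zero.
theorem mem_span_image_Ioi_of_isWeaklyRegular {R : Type*} [CommRing R] [IsNoetherianRing R]
    [IsLocalRing R] {d : ℕ} (a : Fin d → R) (hm : ∀ i, a i ∈ IsLocalRing.maximalIdeal R)
    (ha : IsWeaklyRegular R (List.ofFn a)) (i : Fin d) {y : R}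
    (hy : a i * y ∈ Ideal.span (a '' Set.Ioi i)) : y ∈ Ideal.span (a '' Set.Ioi i) := by
  have h := IsLocalRing.isWeaklyRegular_of_perm_of_subset_maximalIdeal ha
    (Equiv.Perm.ofFn_comp_perm Fin.revPerm a).symm (by simpa [List.mem_ofFn] using hm)
  have h1 := h.regular_mod_prev (Fin.rev i) (by simpa using i.pos)
  have h2 : (Ideal.ofList ((List.ofFn (a ∘ Fin.revPerm)).take (Fin.rev i)) • ⊤ : Ideal R) =
      Ideal.span (a '' Set.Ioi i) := by
    rw [smul_eq_mul, Ideal.mul_top, Ideal.ofList]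
    congr 1
    ext x
    simp only [Set.mem_ofPred_eq, Set.mem_image, Set.mem_Ioi, List.mem_take_iff_getElem]
    constructor
    · rintro ⟨j, hj, rfl⟩
      simp only [List.length_ofFn, lt_inf_iff] at hj
      refine ⟨Fin.rev ⟨j, hj.2⟩, ?_, by simp⟩
      rw [Fin.lt_rev_iff]
      exact hj.1
    · rintro ⟨j, hj, rfl⟩
      refine ⟨Fin.rev j, lt_inf_iff.mpr ⟨Fin.rev_lt_rev.mpr hj, by simpa using i.pos⟩, ?_⟩
      rw [List.getElem_ofFn]
      simp only [Function.comp_apply, Fin.revPerm_apply, Fin.eta, Fin.rev_rev]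
  rw [h2, isSMulRegular_quotient_iff_mem_of_smul_mem] at h1
  refine h1 y ?_
  rw [List.getElem_ofFn]
  simpa only [Function.comp_apply, Fin.revPerm_apply, Fin.eta, Fin.rev_rev, smul_eq_mul] using hy

/-! ### Length bookkeeping -/

namespace Module

variable {R X Y Z : Type*} [CommRing R] [AddCommGroup X] [Module R X] [AddCommGroup Y] [Module R Y]
  [AddCommGroup Z] [Module R Z]

theorem length_eq_length_inf_ker_add_length_map (f : X →ₗ[R] Y) (N : Submodule R X) :
    length R N = length R (N ⊓ LinearMap.ker f : Submodule R X) + length R (N.map f) := by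
  refine length_eq_add_of_exact (Submodule.inclusion inf_le_left)
    (f.restrict (p := N) (q := N.map f) fun x hx => Submodule.mem_map_of_mem hx)
    (Submodule.inclusion_injective _) ?_ ?_
  · rintro ⟨_, x, hx, rfl⟩
    exact ⟨⟨x, hx⟩, rfl⟩
  · rintro ⟨x, hx⟩
    constructor
    · intro h
      have h' : f x = 0 := congrArg Subtype.val h
      exact ⟨⟨x, hx, h'⟩, rfl⟩
    · rintro ⟨⟨y, hy, hy'⟩, h⟩
      have : y = x := congrArg Subtype.val h
      subst this
      exact Subtype.ext hy'

theorem length_map_eq_length_quotient (f : X →ₗ[R] Y) (N L : Submodule R X)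
    (h : N ⊓ LinearMap.ker f = N ⊓ L) :
    length R (N.map f) = length R (N ⧸ L.submoduleOf N) := by
  have hker : LinearMap.ker (f.domRestrict N) = L.submoduleOf N := by
    ext ⟨x, hx⟩
    have := SetLike.ext_iff.mp h x
    simpa [Submodule.submoduleOf, hx] using this
  rw [← (Submodule.quotEquivOfEq _ _ hker).length_eq,
    (LinearMap.quotKerEquivRange (f.domRestrict N)).length_eq, LinearMap.range_domRestrict]

/-- Lets images in unrelated targets be compared through their kernels on $N$, with no isomorphism
to write down. -/
theorem length_map_eq_length_map (f : X →ₗ[R] Y) (g : X →ₗ[R] Z) (N : Submodule R X)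
    (h : N ⊓ LinearMap.ker f = N ⊓ LinearMap.ker g) :
    length R (N.map f) = length R (N.map g) := by
  rw [length_map_eq_length_quotient f N _ h, length_map_eq_length_quotient g N _ rfl]

theorem length_mono {N L : Submodule R X} (h : N ≤ L) : length R N ≤ length R L :=
  length_le_of_injective (Submodule.inclusion h) (Submodule.inclusion_injective h)

end Module

section quotLength

variable {R : Type*} [CommRing R]

theorem quotLength_eq_length_map (N L : Ideal R) :
    quotLength N L = Module.length R (Submodule.map (Submodule.mkQ L) N) :=
  (Module.length_map_eq_length_quotient _ _ _ (by rw [Submodule.ker_mkQ])).symm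

/-- Additivity comes from the surjection $R/L\to R/M$ restricted to the image of $N$: its kernel
there is the image of $M$. -/
theorem quotLength_add {N M L : Ideal R} (hLM : L ≤ M) (hMN : M ≤ N) :
    quotLength N L = quotLength N M + quotLength M L := by
  have h1 : Submodule.map (Submodule.factor hLM) (Submodule.map L.mkQ N) =
      Submodule.map M.mkQ N := by
    rw [← Submodule.map_comp]
    rfl
  have h2 : Submodule.map L.mkQ N ⊓ LinearMap.ker (Submodule.factor hLM) =
      Submodule.map L.mkQ M := by
    ext x
    obtain ⟨x, rfl⟩ := Submodule.mkQ_surjective _ x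
    have h3 : Submodule.factor hLM (L.mkQ x) = 0 ↔ x ∈ M := Submodule.Quotient.mk_eq_zero M
    rw [Submodule.mem_inf, LinearMap.mem_ker, h3]
    constructor
    · rintro ⟨-, h⟩
      exact Submodule.mem_map_of_mem h
    · rintro ⟨y, hy, hyx⟩
      have hyx' : y - x ∈ L := by
        rwa [← Submodule.Quotient.eq]
      have hx : x ∈ M := by simpa using M.sub_mem hy (hLM hyx')
      exact ⟨Submodule.mem_map_of_mem (hMN hx), hx⟩
  rw [quotLength_eq_length_map, quotLength_eq_length_map, quotLength_eq_length_map,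
    Module.length_eq_length_inf_ker_add_length_map (Submodule.factor hLM), add_comm, h1, h2]

theorem quotLength_self (N : Ideal R) : quotLength N N = 0 := by
  rw [quotLength_eq_length_map, Module.length_eq_zero_iff, Submodule.subsingleton_iff_eq_bot,
    ← le_bot_iff, Submodule.map_le_iff_le_comap, Submodule.comap_bot, Submodule.ker_mkQ]

theorem quotLength_eq_zero_iff {N L : Ideal R} : quotLength N L = 0 ↔ N ≤ L := by
  rw [quotLength_eq_length_map, Module.length_eq_zero_iff, Submodule.subsingleton_iff_eq_bot,
    ← le_bot_iff, Submodule.map_le_iff_le_comap, Submodule.comap_bot, Submodule.ker_mkQ]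

theorem quotLength_mono_right {N M L : Ideal R} (hLM : L ≤ M) (hMN : M ≤ N) :
    quotLength N M ≤ quotLength N L := by
  rw [quotLength_add hLM hMN]
  exact le_self_add

theorem quotLength_mono_left {N M L : Ideal R} (hLM : L ≤ M) (hMN : M ≤ N) :
    quotLength M L ≤ quotLength N L := by
  rw [quotLength_add hLM hMN]
  exact le_add_self

/-- Lengths telescope along a descending chain of ideals. -/
theorem sum_quotLength_eq {B : ℕ → Ideal R} (m : ℕ) (hB : ∀ j < m, B (j + 1) ≤ B j) :
    ∑ j ∈ Finset.range m, quotLength (B j) (B (j + 1)) = quotLength (B 0) (B m) := by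
  have key : B m ≤ B 0 ∧ ∑ j ∈ Finset.range m, quotLength (B j) (B (j + 1)) =
      quotLength (B 0) (B m) := by
    induction m with
    | zero => simp [quotLength_self]
    | succ m ih =>
      obtain ⟨h1, h2⟩ := ih fun j hj => hB j (hj.trans (Nat.lt_succ_self m))
      have h3 := hB m (Nat.lt_succ_self m)
      exact ⟨h3.trans h1, by rw [Finset.sum_range_succ, h2, quotLength_add h3 h1]⟩
  exact key.2

end quotLength

/-! ### Monomials, homogeneous forms and quasi-regularity -/

/-- The exponents of the monomials of degree `n` in `d` variables. -/
abbrev MonomialIndex (d n : ℕ) : Type := ↥(Finset.finsuppAntidiag (Finset.univ : Finset (Fin d)) n)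

theorem MonomialIndex.mem_iff {d n : ℕ} {s : Fin d →₀ ℕ} :
    s ∈ Finset.finsuppAntidiag (Finset.univ : Finset (Fin d)) n ↔ s.degree = n := by
  rw [Finset.mem_finsuppAntidiag, Finsupp.degree_eq_sum]
  simp

theorem MonomialIndex.card {d : ℕ} (hd : 0 < d) (n : ℕ) :
    Fintype.card (MonomialIndex d n) = (n + (d - 1)).choose (d - 1) := by
  rw [Fintype.card_coe, Finset.card_finsuppAntidiag_nat_eq_choose, Finset.card_univ,
    Fintype.card_fin, ← Nat.choose_symm_of_eq_add (a := n) (b := d - 1) (by omega)]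
  congr 1
  omega

section pi

variable {R X : Type*} [CommRing R] [AddCommGroup X] [Module R X]

/-- On tuples from $K$ the map has the kernel of the coordinatewise quotient by $B$, so the image
has the length of one copy of $K/(K\cap B)$ per index. -/
theorem length_map_pi {ι : Type*} [Fintype ι] (f : (ι → R) →ₗ[R] X) (K B : Ideal R)
    (h : ∀ c : ι → R, (∀ i, c i ∈ K) → (f c = 0 ↔ ∀ i, c i ∈ B)) :
    Module.length R ((Submodule.pi Set.univ fun _ : ι => K).map f) =
      Fintype.card ι * quotLength K B := by
  let g : (ι → R) →ₗ[R] (ι → R ⧸ B) := LinearMap.pi fun i => B.mkQ ∘ₗ LinearMap.proj i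
  rw [Module.length_map_eq_length_map f g]
  · rw [quotLength_eq_length_map]
    let e : ((Submodule.pi Set.univ fun _ : ι => K).map g) ≃ₗ[R] (ι → Submodule.map B.mkQ K) :=
      { toFun := fun x i => ⟨x.1 i, by
          obtain ⟨_, c, hc, rfl⟩ := x
          exact Submodule.mem_map_of_mem (hc i trivial)⟩
        map_add' := fun _ _ => rfl
        map_smul' := fun _ _ => rfl
        invFun := fun y => ⟨fun i => (y i).1, by
          choose c hc hcy using fun i => Submodule.mem_map.mp (y i).2
          exact ⟨c, fun i _ => hc i, funext hcy⟩⟩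
        left_inv := fun _ => rfl
        right_inv := fun _ => rfl }
    rw [e.length_eq, Module.length_pi, ENat.card_eq_coe_fintype_card]
  · ext c
    simp only [Submodule.mem_inf, LinearMap.mem_ker, Submodule.mem_pi, Set.mem_univ, true_imp_iff]
    refine and_congr_right fun hc => (h c hc).trans ?_
    simp only [g, funext_iff, LinearMap.pi_apply, LinearMap.comp_apply, LinearMap.proj_apply,
      Submodule.mkQ_apply, Pi.zero_apply, Submodule.Quotient.mk_eq_zero]

end pi

section monomials

variable {R : Type*} [CommRing R] {d : ℕ}

/-- The homogeneous polynomial with given coefficients. -/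
noncomputable def homogPoly {n : ℕ} (c : MonomialIndex d n → R) : MvPolynomial (Fin d) R :=
  ∑ s, MvPolynomial.monomial s.1 (c s)

theorem homogPoly_isHomogeneous {n : ℕ} (c : MonomialIndex d n → R) :
    (homogPoly c).IsHomogeneous n :=
  MvPolynomial.IsHomogeneous.sum _ _ _ fun s _ =>
    MvPolynomial.isHomogeneous_monomial _ (MonomialIndex.mem_iff.mp s.2)

theorem coeff_homogPoly {n : ℕ} (c : MonomialIndex d n → R) (s : Fin d →₀ ℕ) :
    (homogPoly c).coeff s = if h : s.degree = n then c ⟨s, MonomialIndex.mem_iff.mpr h⟩ else 0 := by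
  classical
  rw [homogPoly, MvPolynomial.coeff_sum]
  simp only [MvPolynomial.coeff_monomial]
  split_ifs with h
  · rw [Finset.sum_eq_single ⟨s, MonomialIndex.mem_iff.mpr h⟩] <;> simp +contextual
  · refine Finset.sum_eq_zero fun t _ => ?_
    rw [if_neg]
    rintro rfl
    exact h (MonomialIndex.mem_iff.mp t.2)

theorem coeff_homogPoly_mem {n : ℕ} {c : MonomialIndex d n → R} {K : Ideal R} (hc : ∀ s, c s ∈ K)
    (s : Fin d →₀ ℕ) : (homogPoly c).coeff s ∈ K := by
  rw [coeff_homogPoly]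
  split_ifs
  · exact hc _
  · exact zero_mem _

theorem homogPoly_coeff {n : ℕ} {F : MvPolynomial (Fin d) R} (hF : F.IsHomogeneous n) :
    homogPoly (fun s : MonomialIndex d n => F.coeff s.1) = F := by
  ext s
  rw [coeff_homogPoly]
  split_ifs with h
  · rfl
  · rw [hF.coeff_eq_zero h]

/-- Evaluation of homogeneous polynomials of degree `n`, in terms of their coefficients. -/
noncomputable def evalHomog (a : Fin d → R) (n : ℕ) : (MonomialIndex d n → R) →ₗ[R] R :=
  Fintype.linearCombination R fun s => ∏ i, a i ^ s.1 i

theorem evalHomog_eq (a : Fin d → R) {n : ℕ} (c : MonomialIndex d n → R) :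
    evalHomog a n c = MvPolynomial.eval a (homogPoly c) := by
  simp [evalHomog, homogPoly, Fintype.linearCombination_apply, MvPolynomial.eval_monomial,
    Finsupp.prod_fintype]

theorem map_evalHomog (a : Fin d → R) (n : ℕ) (K : Ideal R) :
    (Submodule.pi Set.univ fun _ : MonomialIndex d n => K).map (evalHomog a n) =
      K * Ideal.span (Set.range a) ^ n := by
  apply le_antisymm
  · rintro _ ⟨c, hc, rfl⟩
    rw [evalHomog_eq]
    exact MvPolynomial.eval_mem_mul_span_pow a K (homogPoly_isHomogeneous c)
      (coeff_homogPoly_mem fun s => hc s trivial)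
  · intro y hy
    obtain ⟨F, hF, hFK, rfl⟩ := MvPolynomial.exists_isHomogeneous_eval_eq_of_mem a K n hy
    exact ⟨fun s => F.coeff s.1, fun s _ => hFK s.1, by rw [evalHomog_eq, homogPoly_coeff hF]⟩

/-- `a` is a quasi-regular sequence. -/
def IsQuasiRegular (a : Fin d → R) : Prop :=
  ∀ (n : ℕ) (F : MvPolynomial (Fin d) R), F.IsHomogeneous n →
    MvPolynomial.eval a F ∈ Ideal.span (Set.range a) ^ (n + 1) →
      ∀ s, F.coeff s ∈ Ideal.span (Set.range a)

/-- By quasi-regularity a form with coefficients in $K$ has value in $J^{n+1}$ only if its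
coefficients lie in $J$. The case of the unit ideal gives the length of $R/J^n$; the case $K=I$
bounds $\Sigma$ from below. -/
theorem IsQuasiRegular.quotLength_mul_pow {a : Fin d → R} (ha : IsQuasiRegular a) (n : ℕ)
    {K : Ideal R} :
    quotLength (K * Ideal.span (Set.range a) ^ n) (Ideal.span (Set.range a) ^ (n + 1)) =
      Fintype.card (MonomialIndex d n) * quotLength K (Ideal.span (Set.range a)) := by
  set J := Ideal.span (Set.range a)
  rw [quotLength_eq_length_map, ← map_evalHomog, ← Submodule.map_comp]
  refine length_map_pi _ _ _ fun c _ => ?_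
  rw [LinearMap.comp_apply, Submodule.mkQ_apply, Submodule.Quotient.mk_eq_zero]
  constructor
  · intro h s
    rw [evalHomog_eq] at h
    have := ha n _ (homogPoly_isHomogeneous c) h s.1
    rwa [coeff_homogPoly, dif_pos (MonomialIndex.mem_iff.mp s.2)] at this
  · intro h
    rw [pow_succ', ← map_evalHomog]
    exact Submodule.mem_map_of_mem fun s _ => h s

end monomials

open RingTheory.Sequence in
theorem isQuasiRegular_of_isWeaklyRegular {R : Type*} [CommRing R] [IsNoetherianRing R]
    [IsLocalRing R] {d : ℕ} (a : Fin d → R) (hm : ∀ i, a i ∈ IsLocalRing.maximalIdeal R)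
    (ha : IsWeaklyRegular R (List.ofFn a)) : IsQuasiRegular a := by
  intro n F hF h s
  refine MvPolynomial.coeff_mem_of_eval_mem_pow a (fun G hG h0 => ?_) hF h s
  exact MvPolynomial.coeff_mem_span_of_eval_eq_zero a
    (fun i y => mem_span_image_Ioi_of_isWeaklyRegular a hm ha i) hG h0

/-! ### Eventually polynomial functions and the Hilbert-Serre theorem -/

/-- `f : ℕ → ℤ` agrees for large arguments with an integer-valued polynomial of degree less
than `k`, in terms of iterated differences. -/
def EventuallyPoly : ℕ → (ℕ → ℤ) → Prop
  | 0, f => ∃ N, ∀ n ≥ N, f n = 0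
  | k + 1, f => EventuallyPoly k fun n => f (n + 1) - f n

namespace EventuallyPoly

theorem sub {k : ℕ} {f g : ℕ → ℤ} (hf : EventuallyPoly k f) (hg : EventuallyPoly k g) :
    EventuallyPoly k fun n => f n - g n := by
  induction k generalizing f g with
  | zero =>
    obtain ⟨N, hN⟩ := hf
    obtain ⟨N', hN'⟩ := hg
    exact ⟨max N N', fun n hn => by
      change f n - g n = 0
      rw [hN n (le_trans (le_max_left _ _) hn), hN' n (le_trans (le_max_right _ _) hn), sub_zero]⟩
  | succ k ih =>
    have := ih (f := fun n => f (n + 1) - f n) (g := fun n => g (n + 1) - g n) hf hg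
    rw [EventuallyPoly]
    convert this using 2
    ring

theorem of_shift_one {k : ℕ} {f : ℕ → ℤ} (hf : EventuallyPoly k fun n => f (n + 1)) :
    EventuallyPoly k f := by
  induction k generalizing f with
  | zero =>
    obtain ⟨N, hN⟩ := hf
    refine ⟨N + 1, fun n hn => ?_⟩
    obtain ⟨m, rfl⟩ := Nat.exists_eq_add_of_le' (show 1 ≤ n by omega)
    exact hN m (by omega)
  | succ k ih => exact ih (f := fun n => f (n + 1) - f n) hf

theorem of_shift {k : ℕ} {f : ℕ → ℤ} (r : ℕ) (hf : EventuallyPoly k fun n => f (n + r)) :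
    EventuallyPoly k f := by
  induction r generalizing f with
  | zero => exact hf
  | succ r ih => exact of_shift_one (ih (f := fun n => f (n + 1)) (by convert hf using 2; ring_nf))

theorem exists_eq_sum_choose {k : ℕ} {f : ℕ → ℤ} (hf : EventuallyPoly k f) :
    ∃ (c : ℕ → ℤ) (N : ℕ), ∀ n ≥ N, f n = ∑ j ∈ Finset.range k, c j * ((n + j).choose j : ℤ) := by
  induction k generalizing f with
  | zero => simpa [EventuallyPoly] using hf
  | succ k ih =>
    -- Backward differences send $\binom{n+j+1}{j+1}$ to $\binom{n+j}{j}$, so the coefficients just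
    -- move up one index. The truncated value at $m=0$ is never used.
    obtain ⟨c, N, hc⟩ := ih (f := fun m => f m - f (m - 1)) (of_shift_one hf)
    set g : ℕ → ℤ := fun n => ∑ j ∈ Finset.range k, c j * ((n + (j + 1)).choose (j + 1) : ℤ) with hg
    have hconst : ∀ n ≥ N, f n - g n = f N - g N := by
      intro n hn
      induction n, hn using Nat.le_induction with
      | base => rfl
      | succ n hn ih' =>
        rw [← ih']
        have h1 := hc (n + 1) (by omega)
        have h2 : g (n + 1) = g n + ∑ j ∈ Finset.range k, c j * ((n + 1 + j).choose j : ℤ) := by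
          rw [hg, ← Finset.sum_add_distrib]
          refine Finset.sum_congr rfl fun j _ => ?_
          rw [← mul_add, show n + 1 + (j + 1) = (n + (j + 1)) + 1 by ring, Nat.choose_succ_succ,
            show n + 1 + j = n + (j + 1) by ring]
          push_cast
          ring
        simp only [Nat.add_sub_cancel] at h1
        rw [h2]
        linear_combination h1
    refine ⟨fun j => if j = 0 then f N - g N else c (j - 1), N, fun n hn => ?_⟩
    rw [Finset.sum_range_succ']
    have := hconst n hn
    simp only [Nat.add_eq_zero_iff, one_ne_zero, and_false, if_false, Nat.add_sub_cancel, if_true,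
      Nat.choose_zero_right, Nat.cast_one, mul_one]
    change f n = g n + _
    linear_combination this

end EventuallyPoly

/-- A graded family of modules with degree one operators satisfies the ascending chain condition
on stable families of submodules. -/
def GradedACC {R : Type*} [CommRing R] {k : ℕ} {M : ℕ → Type*} [∀ n, AddCommGroup (M n)]
    [∀ n, Module R (M n)] (T : Fin k → ∀ n, M n →ₗ[R] M (n + 1)) : Prop :=
  ∀ N : ℕ → ∀ n, Submodule R (M n), (∀ n, Monotone fun l => N l n) →
    (∀ l i n, N l n ≤ (N l (n + 1)).comap (T i n)) → ∃ l₀, ∀ l ≥ l₀, ∀ n, N l n = N l₀ n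

/-- The operator `T 0` vanishes on its own kernel, so stability under the other $k$ operators is
enough. -/
theorem GradedACC.ker {R : Type*} [CommRing R] {k : ℕ} {M : ℕ → Type*} [∀ n, AddCommGroup (M n)]
    [∀ n, Module R (M n)] {T : Fin (k + 1) → ∀ n, M n →ₗ[R] M (n + 1)} (hT : GradedACC T)
    (h : ∀ (i : Fin k) n, ∀ x ∈ LinearMap.ker (T 0 n),
      T i.succ n x ∈ LinearMap.ker (T 0 (n + 1))) :
    GradedACC (M := fun n => LinearMap.ker (T 0 n))
      fun (i : Fin k) n => (T i.succ n).restrict (h i n) := by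
  intro N hmono hstab
  obtain ⟨l₀, hl₀⟩ := hT (fun l n => (N l n).map (Submodule.subtype _))
    (fun n l l' hll' => Submodule.map_mono (hmono n hll')) (by
      rintro l i n _ ⟨⟨x, hx⟩, hxN, rfl⟩
      refine Fin.cases ?_ (fun i => ?_) i
      · rw [Submodule.mem_comap]
        have h0 : T 0 n (Submodule.subtype _ ⟨x, hx⟩) = 0 := hx
        rw [h0]
        exact zero_mem _
      · exact ⟨_, hstab l i n hxN, rfl⟩)
  exact ⟨l₀, fun l hl n =>
    Submodule.map_injective_of_injective (Submodule.subtype_injective _) (hl₀ l hl n)⟩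

theorem GradedACC.coker {R : Type*} [CommRing R] {k : ℕ} {M : ℕ → Type*}
    [∀ n, AddCommGroup (M n)]
    [∀ n, Module R (M n)] {T : Fin (k + 1) → ∀ n, M n →ₗ[R] M (n + 1)} (hT : GradedACC T)
    (h : ∀ (i : Fin k) n, LinearMap.range (T 0 n) ≤
      (LinearMap.range (T 0 (n + 1))).comap (T i.succ (n + 1))) :
    GradedACC (M := fun n => M (n + 1) ⧸ LinearMap.range (T 0 n))
      fun (i : Fin k) n => Submodule.mapQ _ _ (T i.succ (n + 1)) (h i n) := by
  intro N hmono hstab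
  obtain ⟨l₀, hl₀⟩ := hT
    -- The cokernel family starts in degree one of `M`, so the pulled back family is filled with `⊥`
    -- in degree zero. Stability under `T 0` is automatic, since its range dies in the quotient.
    (fun l n => n.casesOn ⊥ fun n => (N l n).comap (Submodule.mkQ _))
    (fun n l l' hll' => by
      cases n with
      | zero => exact le_rfl
      | succ n => exact Submodule.comap_mono (hmono n hll')) (by
      intro l i n
      cases n with
      | zero => exact bot_le
      | succ n =>
        intro x hx
        refine Fin.cases ?_ (fun i => ?_) i
        · have h0 : (LinearMap.range (T 0 (n + 1))).mkQ (T 0 (n + 1) x) = 0 :=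
            (Submodule.Quotient.mk_eq_zero _).mpr ⟨x, rfl⟩
          rw [Submodule.mem_comap, Submodule.mem_comap, h0]
          exact zero_mem _
        · exact hstab l i n hx)
  refine ⟨l₀, fun l hl n => ?_⟩
  exact Submodule.comap_injective_of_surjective (Submodule.mkQ_surjective _) (hl₀ l hl (n + 1))

/-- The Hilbert-Serre theorem: the lengths of the pieces of a graded Noetherian module over a
polynomial ring in `k` variables are given by a polynomial of degree less than `k`. -/
theorem eventuallyPoly_length {R : Type*} [CommRing R] {k : ℕ} {M : ℕ → Type*}
    [∀ n, AddCommGroup (M n)] [∀ n, Module R (M n)] (T : Fin k → ∀ n, M n →ₗ[R] M (n + 1))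
    (hcomm : ∀ i j n x, T i (n + 1) (T j n x) = T j (n + 1) (T i n x))
    (hfin : ∀ n, Module.length R (M n) ≠ ⊤) (hT : GradedACC T) :
    EventuallyPoly k fun n => ((Module.length R (M n)).toNat : ℤ) := by
  induction k generalizing M with
  | zero =>
    -- Without operators the truncations form an ascending chain; its stabilization forces the
    -- pieces to vanish in large degrees.
    obtain ⟨l₀, hl₀⟩ := hT (fun l n => if n < l then ⊤ else ⊥)
      (fun n l l' hll' => by
        dsimp only
        split_ifs with h1 h2
        · exact le_rfl
        · exact absurd (h1.trans_le hll') h2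
        · exact bot_le
        · exact le_rfl) (fun l i => i.elim0)
    refine ⟨l₀, fun n hn => ?_⟩
    have h := hl₀ (n + 1) (by omega) n
    rw [if_pos (Nat.lt_succ_self n), if_neg (by omega)] at h
    have : Subsingleton (M n) := (Submodule.subsingleton_iff R).mp (subsingleton_of_bot_eq_top h.symm)
    simp [Module.length_eq_zero]
  | succ k ih =>
    have hk : ∀ (i : Fin k) n, ∀ x ∈ LinearMap.ker (T 0 n),
        T i.succ n x ∈ LinearMap.ker (T 0 (n + 1)) := by
      intro i n x hx
      rw [LinearMap.mem_ker] at hx ⊢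
      rw [hcomm, hx, map_zero]
    have hc : ∀ (i : Fin k) n, LinearMap.range (T 0 n) ≤
        (LinearMap.range (T 0 (n + 1))).comap (T i.succ (n + 1)) := by
      rintro i n _ ⟨x, rfl⟩
      exact ⟨T i.succ n x, hcomm _ _ _ _⟩
    have hkfin : ∀ n, Module.length R (LinearMap.ker (T 0 n)) ≠ ⊤ := fun n =>
      ne_top_of_le_ne_top (hfin n)
        (Module.length_le_of_injective _ (Submodule.subtype_injective _))
    have hcfin : ∀ n, Module.length R (M (n + 1) ⧸ LinearMap.range (T 0 n)) ≠ ⊤ := fun n =>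
      ne_top_of_le_ne_top (hfin (n + 1))
        (Module.length_le_of_surjective _ (Submodule.mkQ_surjective _))
    have h1 := ih (M := fun n => LinearMap.ker (T 0 n))
      (fun i n => (T i.succ n).restrict (hk i n))
      (fun i j n x => Subtype.ext (hcomm _ _ _ _)) hkfin (hT.ker hk)
    have h2 := ih (M := fun n => M (n + 1) ⧸ LinearMap.range (T 0 n))
      (fun i n => Submodule.mapQ _ _ (T i.succ (n + 1)) (hc i n))
      (fun i j n x => by
        obtain ⟨x, rfl⟩ := Submodule.Quotient.mk_surjective _ x
        simp only [Submodule.mapQ_apply, hcomm i.succ j.succ]) hcfin (hT.coker hc)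
    rw [EventuallyPoly]
    convert h2.sub h1 using 2 with n
    -- The two short exact sequences through the range of `T 0 n` show that the first difference of
    -- the length is the length of the cokernel minus that of the kernel.
    have e1 := Module.length_eq_add_of_exact (LinearMap.ker (T 0 n)).subtype
      (T 0 n).rangeRestrict (Submodule.subtype_injective _) (LinearMap.surjective_rangeRestrict _) (by
        rw [LinearMap.exact_iff, LinearMap.ker_rangeRestrict, Submodule.range_subtype])
    have e2 := Module.length_eq_add_of_exact (LinearMap.range (T 0 n)).subtype
      (LinearMap.range (T 0 n)).mkQ (Submodule.subtype_injective _) (Submodule.mkQ_surjective _)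
      (by rw [LinearMap.exact_iff, Submodule.ker_mkQ, Submodule.range_subtype])
    have hr : Module.length R (LinearMap.range (T 0 n)) ≠ ⊤ :=
      ne_top_of_le_ne_top (hfin (n + 1))
        (Module.length_le_of_injective _ (Submodule.subtype_injective _))
    have e1' := congrArg ENat.toNat e1
    have e2' := congrArg ENat.toNat e2
    rw [ENat.toNat_add (hkfin n) hr] at e1'
    rw [ENat.toNat_add hr (hcfin n)] at e2'
    omega

/-! ### Finite lengths and powers of a reduction -/

theorem quotLength_top {R : Type*} [CommRing R] (J : Ideal R) :
    quotLength ⊤ J = Module.length R (R ⧸ J) := by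
  rw [quotLength_eq_length_map, Submodule.map_top, Submodule.range_mkQ, Module.length_top]

theorem isArtinianRing_quotient_of_maximalIdeal_pow_le {R : Type*} [CommRing R]
    [IsNoetherianRing R] [IsLocalRing R] {J : Ideal R} {k : ℕ}
    (h : IsLocalRing.maximalIdeal R ^ k ≤ J) : IsArtinianRing (R ⧸ J) := by
  rcases eq_or_ne J ⊤ with rfl | hJ
  · have : Subsingleton (R ⧸ (⊤ : Ideal R)) := Ideal.Quotient.subsingleton_iff.mpr rfl
    infer_instance
  · have := Ideal.Quotient.nontrivial_iff.mpr hJ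
    have : IsLocalRing (R ⧸ J) := .of_surjective' _ Ideal.Quotient.mk_surjective
    rw [isArtinianRing_iff_isNilpotent_maximalIdeal]
    refine ⟨k, ?_⟩
    have hle : IsLocalRing.maximalIdeal (R ⧸ J) =
        (IsLocalRing.maximalIdeal R).map (Ideal.Quotient.mk J) :=
      (IsLocalRing.map_maximalIdeal_of_surjective _ Ideal.Quotient.mk_surjective).symm
    rw [hle, ← Ideal.map_pow, Ideal.zero_eq_bot, Ideal.map_eq_bot_iff_le_ker, Ideal.mk_ker]
    exact h

theorem quotLength_top_ne_top {R : Type*} [CommRing R] [IsNoetherianRing R]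
    [IsLocalRing R] {J : Ideal R} {k : ℕ} (h : IsLocalRing.maximalIdeal R ^ k ≤ J) :
    quotLength ⊤ J ≠ ⊤ := by
  have := isArtinianRing_quotient_of_maximalIdeal_pow_le h
  rw [quotLength_top, Module.length_eq_of_surjective (R := R ⧸ J) Ideal.Quotient.mk_surjective]
  exact Module.length_ne_top

section powers

variable {R : Type*} [CommRing R] {d : ℕ} {a : Fin d → R} {I : Ideal R}

theorem pow_add_eq_of_isReduction {I J : Ideal R} {r : ℕ} (h : I ^ (r + 1) = J * I ^ r) (n : ℕ) :
    I ^ (n + r) = J ^ n * I ^ r := by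
  induction n with
  | zero => simp
  | succ n ih => rw [show n + 1 + r = (n + r) + 1 by ring, pow_succ, ih, mul_assoc, ← pow_succ, h,
      ← mul_assoc, ← pow_succ]

/-- The layers $J^j/J^{j+1}$ are free over $R/J$ on the monomials of degree $j$; their ranks add up
by the hockey-stick identity. -/
theorem IsQuasiRegular.quotLength_top_pow (ha : IsQuasiRegular a) (hd : 0 < d) (n : ℕ) :
    quotLength ⊤ (Ideal.span (Set.range a) ^ n) =
      ((n + (d - 1)).choose d : ℕ) * quotLength ⊤ (Ideal.span (Set.range a)) := by
  have h := sum_quotLength_eq (B := fun j => Ideal.span (Set.range a) ^ j) n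
    fun j _ => Ideal.pow_le_pow_right (Nat.le_succ j)
  simp only [pow_zero, Ideal.one_eq_top] at h
  rw [← h, Finset.sum_congr rfl fun j _ => by
    rw [← Ideal.top_mul (Ideal.span (Set.range a) ^ j), ha.quotLength_mul_pow j,
      MonomialIndex.card hd], ← Finset.sum_mul, ← Nat.cast_sum]
  congr 2
  obtain ⟨e, rfl⟩ := Nat.exists_eq_add_of_le' hd
  rw [Nat.add_sub_cancel]
  rcases n with _ | n
  · simp
  · rw [Nat.sum_range_add_choose, show n + 1 + e = n + e + 1 by ring]

/-- The multiplication by an element of `J` from `I ^ n / J ^ n` to `I ^ (n + 1) / J ^ (n + 1)`. -/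
noncomputable def powQuotMul (I J : Ideal R) (hJI : J ≤ I) (r : ℕ) (x : R) (hx : x ∈ J) (n : ℕ) :
    (↥(I ^ (n + r)) ⧸ (J ^ (n + r)).submoduleOf (I ^ (n + r))) →ₗ[R]
      (↥(I ^ (n + 1 + r)) ⧸ (J ^ (n + 1 + r)).submoduleOf (I ^ (n + 1 + r))) :=
  Submodule.mapQ _ _ ((LinearMap.mulLeft R x).restrict fun y hy => by
    rw [show n + 1 + r = n + r + 1 by ring, pow_succ']
    exact Ideal.mul_mem_mul (hJI hx) hy) (by
      rintro ⟨y, hy⟩ hy'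
      change x * y ∈ J ^ (n + 1 + r)
      rw [show n + 1 + r = n + r + 1 by ring, pow_succ']
      exact Ideal.mul_mem_mul hx hy')

/-- Since $I^{n+r}=J^nI^r\subseteq J^n$, the preimages in $I^{n+r}$ of a stable family are the
coefficient conditions of an ideal of the Rees algebra of $J$. That algebra is Noetherian, so the
chain stabilizes. -/
theorem gradedACC_powQuotMul [IsNoetherianRing R] {J : Ideal R} (hJI : J ≤ I) (haJ : ∀ i, a i ∈ J)
    (hspan : J = Ideal.span (Set.range a)) {r : ℕ} (hr : I ^ (r + 1) = J * I ^ r) :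
    GradedACC fun (i : Fin d) n => powQuotMul I J hJI r (a i) (haJ i) n := by
  intro N hmono hstab
  let P : ℕ → ℕ → Ideal R := fun l n =>
    ((N l n).comap (Submodule.mkQ _)).map (Submodule.subtype (I ^ (n + r)))
  have hPmem : ∀ l n x, x ∈ P l n ↔ ∃ hx : x ∈ I ^ (n + r),
      (Submodule.Quotient.mk ⟨x, hx⟩ : ↥(I ^ (n + r)) ⧸ (J ^ (n + r)).submoduleOf _) ∈ N l n := by
    intro l n x
    constructor
    · rintro ⟨⟨x, hx⟩, h, rfl⟩
      exact ⟨hx, h⟩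
    · rintro ⟨hx, h⟩
      exact ⟨⟨x, hx⟩, h, rfl⟩
  have hPmul : ∀ l n, J * P l n ≤ P l (n + 1) := by
    intro l n
    rw [hspan, Ideal.mul_le]
    intro x hx y hy
    obtain ⟨c, rfl⟩ := Ideal.mem_span_range_iff_exists_fun.mp hx
    rw [Finset.sum_mul]
    refine Ideal.sum_mem _ fun i _ => ?_
    rw [mul_assoc]
    refine Ideal.mul_mem_left _ _ ?_
    obtain ⟨hy1, hy2⟩ := (hPmem l n y).mp hy
    exact (hPmem l (n + 1) _).mpr ⟨_, hstab l i n hy2⟩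
  have hPpow : ∀ l i n, J ^ i * P l n ≤ P l (i + n) := by
    intro l i n
    induction i with
    | zero => simp
    | succ i ih =>
      rw [pow_succ', mul_assoc, show i + 1 + n = i + n + 1 by ring]
      exact (Ideal.mul_mono_right ih).trans (hPmul l _)
  let Q : ℕ →o Ideal (reesAlgebra J) :=
    { toFun := fun l =>
        { carrier := {f | ∀ n, f.1.coeff n ∈ P l n}
          add_mem' := fun hf hg n => by
            simpa using Ideal.add_mem _ (hf n) (hg n)
          zero_mem' := fun n => by simp
          smul_mem' := fun g f hf n => by
            change (g.1 * f.1).coeff n ∈ _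
            rw [Polynomial.coeff_mul]
            refine Ideal.sum_mem _ fun p hp => ?_
            rw [← Finset.HasAntidiagonal.mem_antidiagonal.mp hp]
            exact hPpow l _ _ (Ideal.mul_mem_mul (g.2 p.1) (hf p.2)) }
      monotone' := fun l l' hll' f hf n => by
        obtain ⟨h1, h2⟩ := (hPmem _ _ _).mp (hf n)
        exact (hPmem _ _ _).mpr ⟨h1, hmono n hll' h2⟩ }
  obtain ⟨l₀, hl₀⟩ := monotone_stabilizes_iff_noetherian.mpr
    (inferInstance : IsNoetherian (reesAlgebra J) (reesAlgebra J)) Q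
  refine ⟨l₀, fun l hl n => le_antisymm ?_ (hmono n hl)⟩
  intro z hz
  obtain ⟨⟨x, hx⟩, rfl⟩ := Submodule.Quotient.mk_surjective _ z
  -- The index shift by $r$ is what makes the monomial with coefficient $x$ and exponent $n$ an
  -- element of the Rees algebra of $J$.
  have hxJ : x ∈ J ^ n := by
    rw [pow_add_eq_of_isReduction hr] at hx
    exact Ideal.mul_le_left hx
  have hxQ : (⟨monomial n x, reesAlgebra.monomial_mem.mpr hxJ⟩ : reesAlgebra J) ∈ Q l := by
    intro m
    rw [Polynomial.coeff_monomial]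
    split_ifs with h
    · subst h
      exact (hPmem _ _ _).mpr ⟨hx, hz⟩
    · exact zero_mem _
  rw [← hl₀ l hl] at hxQ
  have := hxQ n
  rw [Polynomial.coeff_monomial, if_pos rfl] at this
  exact ((hPmem _ _ _).mp this).2

theorem eventuallyPoly_quotLength_pow [IsNoetherianRing R] {J : Ideal R} (hJI : J ≤ I) (haJ : ∀ i, a i ∈ J)
    (hspan : J = Ideal.span (Set.range a)) {r : ℕ} (hr : I ^ (r + 1) = J * I ^ r)
    (hfin : ∀ n, quotLength (I ^ n) (J ^ n) ≠ ⊤) :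
    EventuallyPoly d fun n => ((quotLength (I ^ n) (J ^ n)).toNat : ℤ) := by
  apply EventuallyPoly.of_shift r
  refine eventuallyPoly_length (fun (i : Fin d) n => powQuotMul I J hJI r (a i) (haJ i) n)
    ?_ (fun n => hfin _) (gradedACC_powQuotMul hJI haJ hspan hr)
  intro i j n x
  obtain ⟨x, rfl⟩ := Submodule.Quotient.mk_surjective _ x
  refine congrArg Submodule.Quotient.mk (Subtype.ext ?_)
  exact mul_left_comm _ _ _

end powers

/-! ### The pieces of the associated graded ring and the module Σ -/

/-- With `homog_mem_map`, this identifies the degree $n$ part of `AssocGr Q` with $Q^n/Q^{n+1}$. -/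
theorem coeff_mem_pow_of_mem_map {S : Type*} [CommRing S] {Q : Ideal S} {f : reesAlgebra Q}
    (hf : f ∈ Q.map (algebraMap S (reesAlgebra Q))) (n : ℕ) : f.1.coeff n ∈ Q ^ (n + 1) := by
  induction hf using Submodule.span_induction generalizing n with
  | mem x hx =>
    obtain ⟨q, hq, rfl⟩ := hx
    change (C q).coeff n ∈ _
    rw [coeff_C]
    split_ifs with h
    · subst h
      simpa using hq
    · exact zero_mem _
  | zero => simp
  | add x y _ _ hx hy => simpa using Ideal.add_mem _ (hx n) (hy n)
  | smul g x _ hx =>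
    change (g.1 * x.1).coeff n ∈ _
    rw [coeff_mul]
    refine Ideal.sum_mem _ fun p hp => ?_
    rw [← Finset.HasAntidiagonal.mem_antidiagonal.mp hp, add_assoc, pow_add]
    exact Ideal.mul_mem_mul (g.2 p.1) (hx p.2)

theorem homog_add {S : Type*} [CommRing S] (Q : Ideal S) (n : ℕ) {x y : S} (hx : x ∈ Q ^ n)
    (hy : y ∈ Q ^ n) : BigradedSally.homog Q n (x + y) (Ideal.add_mem _ hx hy) =
      BigradedSally.homog Q n x hx + BigradedSally.homog Q n y hy :=
  Subtype.ext (map_add (monomial n) x y)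

theorem homog_smul {R S : Type*} [CommRing R] [CommRing S] [Algebra R S] (Q : Ideal S) (n : ℕ)
    (r : R) {x : S} (hx : x ∈ Q ^ n) (hrx : r • x ∈ Q ^ n) :
    BigradedSally.homog Q n (r • x) hrx = r • BigradedSally.homog Q n x hx :=
  Subtype.ext (smul_monomial r n x).symm

theorem homog_mem_map {S : Type*} [CommRing S] {Q : Ideal S} {n : ℕ} {y : S}
    (hy : y ∈ Q ^ (n + 1)) (hy' : y ∈ Q ^ n) :
    BigradedSally.homog Q n y hy' ∈ Q.map (algebraMap S (reesAlgebra Q)) := by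
  rw [pow_succ'] at hy
  have key : ∃ h : y ∈ Q ^ n, BigradedSally.homog Q n y h ∈ Q.map (algebraMap S _) := by
    refine Submodule.mul_induction_on hy (fun q hq z hz => ?_) ?_
    · refine ⟨Ideal.mul_mem_left _ _ hz, ?_⟩
      have h : BigradedSally.homog Q n (q * z) (Ideal.mul_mem_left _ _ hz) =
          algebraMap S (reesAlgebra Q) q * BigradedSally.homog Q n z hz :=
        Subtype.ext (C_mul_monomial).symm
      rw [h]
      exact Ideal.mul_mem_right _ _ (Ideal.mem_map_of_mem _ hq)
    · rintro y z ⟨hy, hy'⟩ ⟨hz, hz'⟩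
      exact ⟨Ideal.add_mem _ hy hz, homog_add Q n hy hz ▸ Ideal.add_mem _ hy' hz'⟩
  exact key.2

namespace BigradedSally

variable {R : Type*} [CommRing R]

theorem diagPart_inf_of_lt {X : Type*} [AddCommGroup X] [Module R X]
    (G : ℕ → ℕ → Submodule R X) (N : Submodule R X) {m n : ℕ} (h : n < m) :
    diagPart G N ⊓ G m n = N ⊓ G m n := by
  refine le_antisymm (inf_le_inf_right _ (iSup₂_le fun _ _ => inf_le_left)) ?_
  refine le_inf ?_ inf_le_right
  obtain ⟨p, rfl⟩ := Nat.exists_eq_add_of_lt h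
  exact le_iSup₂_of_le (f := fun p n => N ⊓ G (n + p + 1) n) p n le_rfl

/-- The map $\varphi$ stands in for directness of the bigrading: it kills every piece of the
diagonal part other than the given bidegree and is injective on the piece of that bidegree. -/
theorem diagPart_inf_of_le {X Q : Type*} [AddCommGroup X] [Module R X] [AddCommGroup Q]
    [Module R Q] (G : ℕ → ℕ → Submodule R X) (N : Submodule R X) {m n : ℕ} (h : m ≤ n)
    (φ : X →ₗ[R] Q) (h0 : ∀ m' n', n' < m' → (m' ≠ m ∨ n' ≠ n) → ∀ x ∈ G m' n', φ x = 0)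
    (hinj : ∀ x ∈ G m n, φ x = 0 → x = 0) :
    diagPart G N ⊓ G m n = ⊥ := by
  rw [eq_bot_iff]
  rintro x ⟨hx, hxG⟩
  have hle : diagPart G N ≤ LinearMap.ker φ :=
    iSup₂_le fun p n' => inf_le_right.trans fun y hy => h0 _ _ (by omega) (by omega) y hy
  exact hinj x hxG (hle hx)

/-- Only pieces with $j<m$ meet the diagonal part, which is why the Hilbert functions stop depending
on $n$ once $n\ge m$. -/
theorem sum_length_diagPart_inf {X : Type*} [AddCommGroup X] [Module R X]
    (G : ℕ → ℕ → Submodule R X) (N : Submodule R X)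
    (hbot : ∀ m n, m ≤ n → diagPart G N ⊓ G m n = ⊥) {m n : ℕ} (h : m ≤ n) :
    ∑ j ∈ Finset.range (n + 1), Module.length R (diagPart G N ⊓ G m j : Submodule R X) =
      ∑ j ∈ Finset.range m, Module.length R (N ⊓ G m j : Submodule R X) := by
  rw [← Finset.sum_subset (Finset.range_mono (show m ≤ n + 1 by omega))]
  · exact Finset.sum_congr rfl fun j hj => by
      rw [diagPart_inf_of_lt G N (Finset.mem_range.mp hj)]
  · intro j _ hj
    rw [hbot m j (by simpa using hj), Module.length_bot]

/-- The degree `m` part of the ideal `(J t ℛ(I)) ^ n` of the Rees algebra. -/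
def jtPiece (I J : Ideal R) (n m : ℕ) : Ideal R :=
  if n ≤ m then J ^ n * I ^ (m - n) else ⊥

theorem jtPiece_zero (I J : Ideal R) (m : ℕ) : jtPiece I J 0 m = I ^ m := by
  simp [jtPiece]

theorem jtPiece_self (I J : Ideal R) (m : ℕ) : jtPiece I J m m = J ^ m := by
  simp [jtPiece]

theorem jtPiece_of_le {n m : ℕ} (I J : Ideal R) (h : n ≤ m) :
    jtPiece I J n m = J ^ n * I ^ (m - n) := if_pos h

theorem jtPiece_one_succ (I J : Ideal R) (m : ℕ) : jtPiece I J 1 (m + 1) = J * I ^ m := by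
  simp [jtPiece]

theorem jtPiece_succ_le {I J : Ideal R} (hJI : J ≤ I) (n m : ℕ) :
    jtPiece I J (n + 1) m ≤ jtPiece I J n m := by
  unfold jtPiece
  split_ifs with h1 h2
  · rw [pow_succ, mul_assoc, show m - n = m - (n + 1) + 1 by omega, pow_succ' I]
    exact Ideal.mul_mono_right (Ideal.mul_mono_left hJI)
  · omega
  all_goals exact bot_le

theorem jtPiece_le_pow {I J : Ideal R} (hJI : J ≤ I) (n m : ℕ) :
    jtPiece I J n m ≤ I ^ m := by
  induction n with
  | zero => rw [jtPiece_zero]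
  | succ n ih => exact (jtPiece_succ_le hJI n m).trans ih

theorem mul_jtPiece_le {I J : Ideal R} (n m : ℕ) :
    jtPiece I J n m * J ≤ jtPiece I J (n + 1) (m + 1) := by
  unfold jtPiece
  by_cases h : n ≤ m
  · rw [if_pos h, if_pos (by omega), pow_succ, Nat.add_sub_add_right, mul_right_comm]
  · rw [if_neg h, if_neg (by omega), Ideal.bot_mul]

/-- A generator of $Jt$ raises the degree by one and contributes a factor in $J$. With
`homog_mem_Jt_pow` this determines each homogeneous part of $(Jt)^n$, in particular that nothing
lives below degree $n$. -/
theorem coeff_mem_jtPiece {I J : Ideal R} (hJI : J ≤ I) {n : ℕ} {y : reesAlgebra I}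
    (hy : y ∈ Jt I J hJI ^ n) (m : ℕ) : y.1.coeff m ∈ jtPiece I J n m := by
  induction n generalizing y m with
  | zero =>
    rw [jtPiece_zero]
    exact y.2 m
  | succ n ih =>
    rw [pow_succ] at hy
    refine Submodule.mul_induction_on hy (fun y hy z hz => ?_) (fun y z hy hz => ?_)
    · induction hz using Submodule.span_induction generalizing y with
      | mem z hz =>
        obtain ⟨c, hc, rfl⟩ := hz
        change (y.1 * monomial 1 c).coeff m ∈ _
        rcases m with _ | m
        · rw [Polynomial.coeff_zero_eq_eval_zero]
          simp
        · rw [Polynomial.coeff_mul_monomial]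
          exact mul_jtPiece_le n m (Ideal.mul_mem_mul (ih hy m) hc)
      | zero => simp
      | add z w _ _ hz hw =>
        rw [mul_add]
        simpa using Ideal.add_mem _ (hz y hy) (hw y hy)
      | smul w z _ hz =>
        rw [smul_eq_mul, ← mul_assoc]
        exact hz _ (Ideal.mul_mem_right _ _ hy)
    · simpa using Ideal.add_mem _ hy hz

theorem homog_mem_Jt_pow {I J : Ideal R} (hJI : J ≤ I) {n m : ℕ} {x : R}
    (hx : x ∈ jtPiece I J n m) (hxI : x ∈ I ^ m) : homog I m x hxI ∈ Jt I J hJI ^ n := by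
  unfold jtPiece at hx
  split_ifs at hx with h
  · obtain ⟨k, rfl⟩ := Nat.exists_eq_add_of_le h
    rw [Nat.add_sub_cancel_left] at hx
    induction n generalizing x with
    | zero => simp
    | succ n ih =>
      rw [pow_succ', mul_assoc] at hx
      have key : ∃ h : x ∈ I ^ (n + 1 + k), homog I (n + 1 + k) x h ∈ Jt I J hJI ^ (n + 1) := by
        refine Submodule.mul_induction_on hx (fun c hc y hy => ?_) ?_
        · have hyI : y ∈ I ^ (n + k) := by
            rw [pow_add]
            exact Ideal.mul_mono_left (Ideal.pow_right_mono hJI n) hy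
          have hcI : c ∈ I ^ 1 := by simpa using hJI hc
          have hcy : c * y ∈ I ^ (n + 1 + k) := by
            rw [show n + 1 + k = 1 + (n + k) by ring, pow_add]
            exact Ideal.mul_mem_mul hcI hyI
          refine ⟨hcy, ?_⟩
          have h1 : homog I (n + 1 + k) (c * y) hcy = homog I 1 c hcI * homog I (n + k) y hyI := by
            refine Subtype.ext ?_
            change monomial (n + 1 + k) (c * y) = monomial 1 c * monomial (n + k) y
            rw [monomial_mul_monomial, show 1 + (n + k) = n + 1 + k by ring]
          rw [h1, pow_succ']
          exact Ideal.mul_mem_mul (by simpa using homog_one_mem_Jt I J hJI c hc)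
            (ih hyI (by omega) hy)
        · rintro y z ⟨hy, hy'⟩ ⟨hz, hz'⟩
          refine ⟨Ideal.add_mem _ hy hz, ?_⟩
          rw [homog_add I _ hy hz]
          exact Ideal.add_mem _ hy' hz'
      exact key.2
  · rw [Submodule.mem_bot] at hx
    subst hx
    have h1 : homog I m 0 hxI = 0 := Subtype.ext (monomial_zero_right _)
    rw [h1]
    exact zero_mem _

theorem homog_mem_Jt_pow_iff {I J : Ideal R} (hJI : J ≤ I) {n m : ℕ} {x : R}
    (hxI : x ∈ I ^ m) : homog I m x hxI ∈ Jt I J hJI ^ n ↔ x ∈ jtPiece I J n m := by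
  refine ⟨fun h => ?_, fun h => homog_mem_Jt_pow hJI h hxI⟩
  have := coeff_mem_jtPiece hJI h m
  change (monomial m x).coeff m ∈ _ at this
  rwa [coeff_monomial, if_pos rfl] at this

theorem grHomog_eq_zero_iff {I J : Ideal R} (hJI : J ≤ I) {n : ℕ} {y : reesAlgebra I}
    (hy : y ∈ Jt I J hJI ^ n) : grHomog I J hJI n y hy = 0 ↔ y ∈ Jt I J hJI ^ (n + 1) := by
  rw [grHomog, Ideal.Quotient.eq_zero_iff_mem]
  constructor
  · intro h
    have := coeff_mem_pow_of_mem_map h n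
    change (monomial n y).coeff n ∈ _ at this
    rwa [coeff_monomial, if_pos rfl] at this
  · intro h
    exact homog_mem_map h hy

/-- The map onto the bidegree `(m, n)` piece of `gr_{Jt}(ℛ(I))`. -/
noncomputable def grMap (I J : Ideal R) (hJI : J ≤ I) (m n : ℕ) :
    jtPiece I J n m →ₗ[R] Gr I J hJI where
  toFun x := grHomog I J hJI n (homog I m x.1 (jtPiece_le_pow hJI n m x.2))
    (homog_mem_Jt_pow hJI x.2 _)
  map_add' x y := by
    rw [grHomog, grHomog, grHomog, ← map_add, ← homog_add]
    exact congrArg (Ideal.Quotient.mk _) (Subtype.ext (congrArg (monomial n) (homog_add I m _ _)))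
  map_smul' r x := by
    have hx := homog_mem_Jt_pow hJI x.2 (jtPiece_le_pow hJI n m x.2)
    have h1 : r • homog I m x.1 (jtPiece_le_pow hJI n m x.2) ∈ Jt I J hJI ^ n := by
      rw [Algebra.smul_def]
      exact Ideal.mul_mem_left _ _ hx
    refine Eq.trans ?_ (congrArg (Ideal.Quotient.mk _) (homog_smul (Jt I J hJI) n r hx h1))
    exact congrArg (Ideal.Quotient.mk _) (Subtype.ext (congrArg (monomial n) (homog_smul I m r _ _)))

theorem range_grMap (I J : Ideal R) (hJI : J ≤ I) (m n : ℕ) :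
    LinearMap.range (grMap I J hJI m n) = grPiece I J hJI m n := by
  rw [grPiece, ← Submodule.span_eq (LinearMap.range _)]
  congr 1
  ext g
  constructor
  · rintro ⟨x, rfl⟩
    exact ⟨x.1, jtPiece_le_pow hJI n m x.2, homog_mem_Jt_pow hJI x.2 _, rfl⟩
  · rintro ⟨x, hx, hy, rfl⟩
    exact ⟨⟨x, (homog_mem_Jt_pow_iff hJI hx).mp hy⟩, rfl⟩

theorem length_grPiece (I J : Ideal R) (hJI : J ≤ I) (m n : ℕ) :
    Module.length R (grPiece I J hJI m n) =
      quotLength (jtPiece I J n m) (jtPiece I J (n + 1) m) := by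
  have hker : LinearMap.ker (grMap I J hJI m n) =
      (jtPiece I J (n + 1) m).submoduleOf (jtPiece I J n m) := by
    ext x
    exact (grHomog_eq_zero_iff hJI _).trans (homog_mem_Jt_pow_iff hJI _)
  rw [← range_grMap, ← (LinearMap.quotKerEquivRange _).length_eq,
    (Submodule.quotEquivOfEq _ _ hker).length_eq, quotLength]

/-- The component of bidegree `(m, n)` on `gr_{Jt}(ℛ(I))`. -/
noncomputable def grProj (I J : Ideal R) (hJI : J ≤ I) (m n : ℕ) :
    Gr I J hJI →ₗ[R] R ⧸ jtPiece I J (n + 1) m where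
  __ := QuotientAddGroup.lift (Submodule.toAddSubgroup _)
    (AddMonoidHom.mk' (fun f : reesAlgebra (Jt I J hJI) =>
      Ideal.Quotient.mk (jtPiece I J (n + 1) m) ((f.1.coeff n).1.coeff m)) fun f g => by simp)
    fun f hf => Ideal.Quotient.eq_zero_iff_mem.mpr
      (coeff_mem_jtPiece hJI (coeff_mem_pow_of_mem_map hf n) m)
  map_smul' r g := by
    obtain ⟨f, rfl⟩ := Ideal.Quotient.mk_surjective g
    change Ideal.Quotient.mk _ (((r • f.1).coeff n).1.coeff m) =
      r • Ideal.Quotient.mk _ ((f.1.coeff n).1.coeff m)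
    rw [coeff_smul]
    change Ideal.Quotient.mk _ ((r • (f.1.coeff n).1).coeff m) = _
    rw [coeff_smul]
    rfl

theorem grProj_grHomog (I J : Ideal R) (hJI : J ≤ I) (m n k : ℕ) (y : reesAlgebra I)
    (hy : y ∈ Jt I J hJI ^ k) : grProj I J hJI m n (grHomog I J hJI k y hy) =
      Ideal.Quotient.mk _ (((monomial k y).coeff n).1.coeff m) := rfl

theorem diagPart_grPiece_inf_of_le (I J : Ideal R) (hJI : J ≤ I)
    (N : Submodule R (Gr I J hJI)) {m n : ℕ} (h : m ≤ n) :
    diagPart (grPiece I J hJI) N ⊓ grPiece I J hJI m n = ⊥ := by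
  refine diagPart_inf_of_le _ N h (grProj I J hJI m n) ?_ ?_
  · intro m' n' _ hne x hx
    rw [← range_grMap] at hx
    obtain ⟨x, rfl⟩ := hx
    change grProj I J hJI m n (grHomog I J hJI n' (homog I m' x.1 _) _) = 0
    rw [grProj_grHomog, coeff_monomial]
    split_ifs with h1
    · subst h1
      change Ideal.Quotient.mk _ ((monomial m' x.1).coeff m) = 0
      rw [coeff_monomial, if_neg (by simpa using hne), map_zero]
    · simp
  · intro x hx h0
    rw [← range_grMap] at hx
    obtain ⟨x, rfl⟩ := hx
    change grProj I J hJI m n (grHomog I J hJI n (homog I m x.1 _) _) = 0 at h0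
    rw [grProj_grHomog, coeff_monomial, if_pos rfl] at h0
    change Ideal.Quotient.mk _ ((monomial m x.1).coeff m) = 0 at h0
    rw [coeff_monomial, if_pos rfl, Ideal.Quotient.eq_zero_iff_mem] at h0
    exact (grHomog_eq_zero_iff hJI _).mpr ((homog_mem_Jt_pow_iff hJI _).mpr h0)

/-- The pieces in the row $m$ are the successive quotients of the chain $I^m\supseteq
JI^{m-1}\supseteq\cdots\supseteq J^m$. -/
theorem hilbertSigma_eq (I J : Ideal R) (hJI : J ≤ I) {m n : ℕ} (h : m ≤ n) :
    hilbertSigma I J hJI m n = quotLength (I ^ m) (J ^ m) := by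
  have h0 : hilbertSigma I J hJI m n = ∑ j ∈ Finset.range (n + 1), Module.length R
      (diagPart (grPiece I J hJI) ⊤ ⊓ grPiece I J hJI m j : Submodule R (Gr I J hJI)) := rfl
  rw [h0, sum_length_diagPart_inf _ _ (fun _ _ h => diagPart_grPiece_inf_of_le I J hJI ⊤ h) h]
  have h1 : ∀ j, Module.length R (⊤ ⊓ grPiece I J hJI m j : Submodule R (Gr I J hJI)) =
      quotLength (jtPiece I J j m) (jtPiece I J (j + 1) m) := fun j => by
    rw [top_inf_eq, length_grPiece]
  rw [Finset.sum_congr rfl fun j _ => h1 j,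
    sum_quotLength_eq (B := fun j => jtPiece I J j m) m fun j _ => jtPiece_succ_le hJI j m,
    jtPiece_zero, jtPiece_self]

/-- The piece of bidegree $(1,0)$ is $I/J$. Conversely, if $I=J$ then $J^nI^{m-n}=I^m$ for every
$n\le m$, and all successive quotients with $n<m$ vanish. -/
theorem sigmaMod_eq_bot_iff (I J : Ideal R) (hJI : J ≤ I) : sigmaMod I J hJI = ⊥ ↔ I = J := by
  constructor
  · intro h
    refine le_antisymm ?_ hJI
    have h1 : grPiece I J hJI 1 0 = ⊥ := by
      have := diagPart_inf_of_lt (grPiece I J hJI) ⊤ (show 0 < 1 by omega)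
      rw [sigmaMod] at h
      rwa [h, bot_inf_eq, top_inf_eq, eq_comm] at this
    have h2 := length_grPiece I J hJI 1 0
    rw [h1, Module.length_bot, eq_comm, quotLength_eq_zero_iff, jtPiece_zero, jtPiece_self,
      pow_one, pow_one] at h2
    exact h2
  · rintro rfl
    rw [sigmaMod, diagPart, eq_bot_iff]
    refine iSup₂_le fun p n => ?_
    rw [top_inf_eq, le_bot_iff, ← Submodule.subsingleton_iff_eq_bot, ← Module.length_eq_zero_iff
      (R := R), length_grPiece, quotLength_eq_zero_iff]
    rw [jtPiece_of_le _ _ (by omega), jtPiece_of_le _ _ (by omega), ← pow_add, ← pow_add]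
    exact Ideal.pow_le_pow_right (by omega)

end BigradedSally

/-! ### Homogeneous polynomials over an algebra -/

section abstractPoly

variable {R A V : Type*} [CommRing R] [CommRing A] [Algebra R A] [AddCommGroup V] [Module R V]
  {d : ℕ}

/-- The homogeneous polynomials of degree `n` with coefficients in the image of `ψ`. -/
noncomputable def polyMap (d : ℕ) (ψ : V →ₗ[R] A) (n : ℕ) :
    (MonomialIndex d n → V) →ₗ[R] MvPolynomial (Fin d) A where
  toFun c := homogPoly fun s => ψ (c s)
  map_add' c c' := by simp [homogPoly, Finset.sum_add_distrib]
  map_smul' r c := by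
    simp only [homogPoly, Finset.smul_sum, Pi.smul_apply, map_smul, RingHom.id_apply,
      MvPolynomial.smul_monomial]

theorem coeff_polyMap_mem (ψ : V →ₗ[R] A) {n : ℕ} (c : MonomialIndex d n → V) (s : Fin d →₀ ℕ) :
    (polyMap d ψ n c).coeff s ∈ LinearMap.range ψ := by
  change (homogPoly fun s => ψ (c s)).coeff s ∈ _
  rw [coeff_homogPoly]
  split_ifs
  · exact ⟨_, rfl⟩
  · exact zero_mem _

theorem homogPoly_eq_zero_iff {n : ℕ} {c : MonomialIndex d n → A} :
    homogPoly c = 0 ↔ ∀ s, c s = 0 := by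
  constructor
  · intro h s
    have := congrArg (MvPolynomial.coeff s.1) h
    rwa [coeff_homogPoly, dif_pos (MonomialIndex.mem_iff.mp s.2), MvPolynomial.coeff_zero] at this
  · intro h
    simp [homogPoly, h]

theorem polyMap_single (ψ : V →ₗ[R] A) {n : ℕ} (s : MonomialIndex d n) (v : V) :
    polyMap d ψ n (Pi.single s v) = MvPolynomial.monomial s.1 (ψ v) := by
  classical
  change (homogPoly fun t => ψ ((Pi.single s v : _ → V) t)) = _
  rw [homogPoly, Finset.sum_eq_single s]
  · simp
  · intro t _ hts
    simp [Pi.single_eq_of_ne hts]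
  · simp

theorem length_range_polyMap (ψ : V →ₗ[R] A) (n : ℕ) :
    Module.length R (LinearMap.range (polyMap d ψ n)) =
      Fintype.card (MonomialIndex d n) * Module.length R (LinearMap.range ψ) := by
  let g : (MonomialIndex d n → V) →ₗ[R] (MonomialIndex d n → LinearMap.range ψ) :=
    LinearMap.pi fun i => ψ.rangeRestrict ∘ₗ LinearMap.proj i
  have hg : LinearMap.range g = ⊤ := by
    rw [LinearMap.range_eq_top]
    intro y
    choose c hc using fun i => (y i).2
    exact ⟨c, funext fun i => Subtype.ext (hc i)⟩
  have h := Module.length_map_eq_length_map (polyMap d ψ n) g ⊤ (by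
    congr 1
    ext c
    rw [LinearMap.mem_ker, LinearMap.mem_ker, funext_iff]
    refine homogPoly_eq_zero_iff.trans (forall_congr' fun s => ?_)
    exact (Subtype.ext_iff (a1 := ψ.rangeRestrict (c s)) (a2 := 0)).symm)
  rw [Submodule.map_top, Submodule.map_top, hg, Module.length_top, Module.length_pi,
    ENat.card_eq_coe_fintype_card] at h
  exact h

/-- A nonzero polynomial killed by the maximal ideal generates a free module over the polynomial
ring over the residue field. -/
theorem length_map_mul_of_maximalIdeal_smul [IsLocalRing R] (f : MvPolynomial (Fin d) A)
    (hf : f ≠ 0) (hmf : ∀ r ∈ IsLocalRing.maximalIdeal R, r • f = 0) (n : ℕ) :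
    Module.length R (LinearMap.range
      (LinearMap.mulRight R f ∘ₗ polyMap d (Algebra.linearMap R A) n)) =
      Fintype.card (MonomialIndex d n) := by
  have : Nontrivial A := by
    by_contra h
    rw [not_nontrivial_iff_subsingleton] at h
    exact hf (Subsingleton.elim _ _)
  have h := length_map_pi (LinearMap.mulRight R f ∘ₗ polyMap d (Algebra.linearMap R A) n) ⊤
    (IsLocalRing.maximalIdeal R) (by
      intro c _
      change homogPoly (fun s => algebraMap R A (c s)) * f = 0 ↔ _
      constructor
      · intro h0
        by_contra! hc
        classical
        -- Coefficients in the maximal ideal kill `f` and can be dropped. The surviving ones are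
        -- units, so the lexicographic leading coefficient is a unit and the product with `f` cannot
        -- vanish.
        let c' : MonomialIndex d n → A :=
          fun s => if c s ∈ IsLocalRing.maximalIdeal R then 0 else algebraMap R A (c s)
        have h1 : homogPoly c' * f = 0 := by
          rw [← h0, homogPoly, homogPoly, Finset.sum_mul, Finset.sum_mul]
          refine Finset.sum_congr rfl fun s _ => ?_
          by_cases hs : c s ∈ IsLocalRing.maximalIdeal R
          · have h2 : MvPolynomial.monomial s.1 (algebraMap R A (c s)) =
                c s • MvPolynomial.monomial s.1 (1 : A) := by
              rw [MvPolynomial.smul_monomial, Algebra.algebraMap_eq_smul_one]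
            simp only [c', if_pos hs, map_zero, zero_mul]
            rw [h2, smul_mul_assoc, mul_comm, ← smul_mul_assoc, hmf _ hs, zero_mul]
          · simp only [c', if_neg hs]
        obtain ⟨s₀, hs₀⟩ := hc
        have hu : ∀ r : R, r ∉ IsLocalRing.maximalIdeal R → IsUnit (algebraMap R A r) :=
          fun r hr => (by simpa using hr : IsUnit r).map _
        have hne : homogPoly c' ≠ 0 := by
          rw [Ne, homogPoly_eq_zero_iff]
          intro h
          have := h s₀
          simp only [c', if_neg hs₀] at this
          exact (hu _ hs₀).ne_zero this
        have hlu : IsUnit (MonomialOrder.lex.leadingCoeff (homogPoly c')) := by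
          have hl : MonomialOrder.lex.leadingCoeff (homogPoly c') ≠ 0 := by
            rwa [Ne, MonomialOrder.leadingCoeff_eq_zero_iff]
          rw [MonomialOrder.leadingCoeff, coeff_homogPoly] at hl ⊢
          split_ifs at hl ⊢ with hdeg
          · simp only [c'] at hl ⊢
            split_ifs at hl ⊢ with hm
            · exact absurd rfl hl
            · exact hu _ hm
          · exact absurd rfl hl
        have h3 := MonomialOrder.lex.leadingCoeff_mul_of_isRegular_left (g := f)
          hlu.isRegular
        rw [h1, MonomialOrder.leadingCoeff_zero, eq_comm, hlu.mul_right_eq_zero,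
          MonomialOrder.leadingCoeff_eq_zero_iff] at h3
        exact hf h3
      · intro hc
        rw [homogPoly, Finset.sum_mul]
        refine Finset.sum_eq_zero fun s _ => ?_
        have h2 : MvPolynomial.monomial s.1 (algebraMap R A (c s)) =
            c s • MvPolynomial.monomial s.1 (1 : A) := by
          rw [MvPolynomial.smul_monomial, Algebra.algebraMap_eq_smul_one]
        rw [h2, smul_mul_assoc, mul_comm, ← smul_mul_assoc, hmf _ (hc s), zero_mul])
  have h1 : quotLength ⊤ (IsLocalRing.maximalIdeal R) = 1 := by
    rw [quotLength_top]
    have : IsSimpleModule R (R ⧸ IsLocalRing.maximalIdeal R) :=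
      isSimpleModule_iff_isCoatom.mpr (IsLocalRing.maximalIdeal.isMaximal R).out
    exact Module.length_eq_one R _
  have h2 : (Submodule.pi Set.univ fun _ : MonomialIndex d n => (⊤ : Ideal R)) = ⊤ := by
    ext
    simp
  rw [h2, Submodule.map_top, h1, mul_one] at h
  exact h

end abstractPoly

/-! ### The pieces of the polynomial ring, and the map π -/

namespace BigradedSally

variable {R : Type*} [CommRing R]

/-- The map onto the degree `k` part of `ℛ(I) / J t ℛ(I)`. -/
noncomputable def reesQuotMap (I J : Ideal R) (hJI : J ≤ I) (k : ℕ) :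
    ↥(I ^ k) →ₗ[R] (reesAlgebra I ⧸ Jt I J hJI) where
  toFun x := Ideal.Quotient.mk _ (homog I k x.1 x.2)
  map_add' x y := by
    rw [← map_add, ← homog_add]
    rfl
  map_smul' r x := congrArg (Ideal.Quotient.mk _) (homog_smul I k r x.2 (r • x).2)

theorem reesQuotMap_eq_zero_iff {I J : Ideal R} (hJI : J ≤ I) {k : ℕ} (x : ↥(I ^ k)) :
    reesQuotMap I J hJI k x = 0 ↔ x.1 ∈ jtPiece I J 1 k := by
  refine Ideal.Quotient.eq_zero_iff_mem.trans ?_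
  rw [← homog_mem_Jt_pow_iff hJI x.2, pow_one]

theorem length_range_reesQuotMap (I J : Ideal R) (hJI : J ≤ I) (k : ℕ) :
    Module.length R (LinearMap.range (reesQuotMap I J hJI k)) =
      quotLength (I ^ k) (jtPiece I J 1 k) := by
  have hker : LinearMap.ker (reesQuotMap I J hJI k) =
      (jtPiece I J 1 k).submoduleOf (I ^ k) := by
    ext x
    exact reesQuotMap_eq_zero_iff hJI x
  rw [← (LinearMap.quotKerEquivRange _).length_eq,
    (Submodule.quotEquivOfEq _ _ hker).length_eq, quotLength]

/-- The degree zero component on `ℛ(I) / J t ℛ(I)`. -/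
noncomputable def reesQuotCoeffZero (I J : Ideal R) (hJI : J ≤ I) :
    (reesAlgebra I ⧸ Jt I J hJI) →ₗ[R] R where
  __ := QuotientAddGroup.lift (Submodule.toAddSubgroup _)
    (AddMonoidHom.mk' (fun f : reesAlgebra I => f.1.coeff 0) fun f g => by simp)
    -- The coefficient of degree zero descends to the quotient because the ideal generated by $Jt$
    -- has no part in degree zero.
    fun f hf => by
      have := coeff_mem_jtPiece hJI (n := 1) (by rwa [pow_one]) 0
      rwa [jtPiece, if_neg (by omega)] at this
  map_smul' r g := by
    obtain ⟨f, rfl⟩ := Ideal.Quotient.mk_surjective g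
    exact coeff_smul r f.1 0

theorem reesQuotCoeffZero_reesQuotMap (I J : Ideal R) (hJI : J ≤ I) (k : ℕ) (x : ↥(I ^ k)) :
    reesQuotCoeffZero I J hJI (reesQuotMap I J hJI k x) = (monomial k x.1).coeff 0 := rfl

theorem cPiece_add (I J : Ideal R) (hJI : J ≤ I) (d k n : ℕ) :
    cPiece I J hJI d (n + k) n = LinearMap.range (polyMap d (reesQuotMap I J hJI k) n) := by
  apply le_antisymm
  · rw [cPiece, Submodule.span_le]
    rintro _ ⟨s, k', x, hx, hs, hk, rfl⟩
    obtain rfl : k' = k := by omega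
    exact ⟨_, polyMap_single (reesQuotMap I J hJI k') ⟨s, MonomialIndex.mem_iff.mpr hs⟩ ⟨x, hx⟩⟩
  · rintro _ ⟨c, rfl⟩
    refine Submodule.sum_mem _ fun s _ => Submodule.subset_span ?_
    exact ⟨s.1, k, (c s).1, (c s).2, MonomialIndex.mem_iff.mp s.2, add_comm _ _, rfl⟩

theorem cPiece_of_lt (I J : Ideal R) (hJI : J ≤ I) (d : ℕ) {m n : ℕ} (h : m < n) :
    cPiece I J hJI d m n = ⊥ := by
  rw [cPiece, Submodule.span_eq_bot]
  rintro _ ⟨s, k, x, hx, hs, hk, rfl⟩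
  omega

/-- Pieces with $m<n$ vanish. For $m=n$ the coefficients have degree zero in the Rees quotient,
whereas in the diagonals $p\ge0$ they have positive degree; taking degree-zero parts of the
coefficients separates the two. -/
theorem diagPart_cPiece_inf_of_le (I J : Ideal R) (hJI : J ≤ I) (d : ℕ)
    (N : Submodule R (C I J hJI d)) {m n : ℕ} (h : m ≤ n) :
    diagPart (cPiece I J hJI d) N ⊓ cPiece I J hJI d m n = ⊥ := by
  rcases h.lt_or_eq with h | rfl
  · rw [cPiece_of_lt I J hJI d h, inf_bot_eq]
  let φ : C I J hJI d →ₗ[R] ((Fin d →₀ ℕ) → R) :=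
    { toFun := fun f s => reesQuotCoeffZero I J hJI (MvPolynomial.coeff s f)
      map_add' := fun f g => by
        ext s
        simp
      map_smul' := fun r f => by
        ext s
        rw [MvPolynomial.coeff_smul, map_smul]
        rfl }
  refine diagPart_inf_of_le _ N le_rfl φ ?_ ?_
  · intro m' n' hlt _ x hx
    obtain ⟨k, rfl⟩ := Nat.exists_eq_add_of_lt hlt
    rw [add_assoc, cPiece_add] at hx
    obtain ⟨c, rfl⟩ := hx
    ext s
    obtain ⟨y, hy⟩ := coeff_polyMap_mem (reesQuotMap I J hJI (k + 1)) c s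
    change reesQuotCoeffZero I J hJI (MvPolynomial.coeff s _) = 0
    rw [← hy, reesQuotCoeffZero_reesQuotMap, coeff_monomial, if_neg (by omega)]
  · intro x hx h0
    have hx' : x ∈ cPiece I J hJI d (m + 0) m := hx
    rw [cPiece_add] at hx'
    obtain ⟨c, rfl⟩ := hx'
    ext s
    obtain ⟨y, hy⟩ := coeff_polyMap_mem (reesQuotMap I J hJI 0) c s
    have h1 : reesQuotCoeffZero I J hJI (MvPolynomial.coeff s _) = 0 := congrFun h0 s
    rw [← hy, reesQuotCoeffZero_reesQuotMap, coeff_monomial, if_pos rfl] at h1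
    rw [← hy, MvPolynomial.coeff_zero, reesQuotMap_eq_zero_iff, h1]
    exact zero_mem _

theorem length_cPiece (I J : Ideal R) (hJI : J ≤ I) (d k n : ℕ) :
    Module.length R (cPiece I J hJI d (n + k) n) =
      Fintype.card (MonomialIndex d n) * quotLength (I ^ k) (jtPiece I J 1 k) := by
  rw [cPiece_add, ← length_range_reesQuotMap I J hJI]
  exact length_range_polyMap (reesQuotMap I J hJI k) n

theorem hilbertM_eq (I J : Ideal R) (hJI : J ≤ I) (d : ℕ) {m n : ℕ} (h : m ≤ n) :
    hilbertM I J hJI d m n =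
      ∑ j ∈ Finset.range m, Module.length R (cPiece I J hJI d m j) := by
  have h0 : hilbertM I J hJI d m n = ∑ j ∈ Finset.range (n + 1), Module.length R
      (diagPart (cPiece I J hJI d) ⊤ ⊓ cPiece I J hJI d m j : Submodule R (C I J hJI d)) := rfl
  rw [h0, sum_length_diagPart_inf _ _ (fun _ _ h => diagPart_cPiece_inf_of_le I J hJI d ⊤ h) h]
  exact Finset.sum_congr rfl fun j _ => by rw [top_inf_eq]

/-- `π` as a linear map. -/
noncomputable def piLin (I J : Ideal R) (hJI : J ≤ I) {d : ℕ} (a : Fin d → R)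
    (ha : ∀ i, a i ∈ J) : C I J hJI d →ₗ[R] Gr I J hJI where
  toFun := piMap I J hJI a ha
  map_add' := map_add _
  map_smul' r f := by
    have h1 : r • f = MvPolynomial.C (algebraMap R (reesAlgebra I ⧸ Jt I J hJI) r) * f := by
      rw [Algebra.smul_def]
      rfl
    have h2 : piMap I J hJI a ha (MvPolynomial.C (algebraMap R (reesAlgebra I ⧸ Jt I J hJI) r)) =
        Ideal.Quotient.mk _ (algebraMap R (reesAlgebra (Jt I J hJI)) r) := by
      rw [piMap, MvPolynomial.coe_eval₂Hom, MvPolynomial.eval₂_C]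
      rfl
    rw [h1, map_mul, h2, RingHom.id_apply]
    obtain ⟨g, hg⟩ := Ideal.Quotient.mk_surjective (piMap I J hJI a ha f)
    rw [← hg, ← map_mul, ← Algebra.smul_def]
    rfl

theorem hilbertK_eq (I J : Ideal R) (hJI : J ≤ I) {d : ℕ} (a : Fin d → R)
    (ha : ∀ i, a i ∈ J) {m n : ℕ} (h : m ≤ n) :
    hilbertK I J hJI a ha m n = ∑ j ∈ Finset.range m, Module.length R
      (cPiece I J hJI d m j ⊓ LinearMap.ker (piLin I J hJI a ha) : Submodule R (C I J hJI d)) := by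
  have h0 : hilbertK I J hJI a ha m n = ∑ j ∈ Finset.range (n + 1), Module.length R
      (diagPart (cPiece I J hJI d) (LinearMap.ker (piLin I J hJI a ha)) ⊓
        cPiece I J hJI d m j : Submodule R (C I J hJI d)) := rfl
  rw [h0, sum_length_diagPart_inf _ _ (fun _ _ h => diagPart_cPiece_inf_of_le I J hJI d _ h) h]
  exact Finset.sum_congr rfl fun j _ => by rw [inf_comm]

/-- Applied in three Rees algebras: of $I$ over $R$, of $Jt$ over the first one, and of $J$ over
$R$. -/
theorem prod_homog_pow {I : Ideal R} {d : ℕ} (a : Fin d → R) (haI : ∀ i, a i ∈ I ^ 1)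
    (s : Fin d →₀ ℕ) {k : ℕ} {x : R} (hx : x ∈ I ^ k)
    (hx' : (∏ i, a i ^ s i) * x ∈ I ^ (s.degree + k)) :
    homog I k x hx * ∏ i, homog I 1 (a i) (haI i) ^ s i =
      homog I (s.degree + k) ((∏ i, a i ^ s i) * x) hx' := by
  refine Subtype.ext ?_
  change (reesAlgebra I).val (_ * _) = monomial _ _
  rw [map_mul, map_prod]
  simp only [map_pow]
  change monomial k x * ∏ i, (monomial 1 (a i)) ^ s i = _
  have h1 : ∀ i, (monomial 1 (a i)) ^ s i = Polynomial.C (a i ^ s i) * X ^ s i := fun i => by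
    rw [monomial_pow, one_mul, C_mul_X_pow_eq_monomial]
  rw [Finset.prod_congr rfl fun i _ => h1 i, Finset.prod_mul_distrib, Finset.prod_pow_eq_pow_sum,
    ← map_prod, ← Finsupp.degree_eq_sum, ← C_mul_X_pow_eq_monomial, ← C_mul_X_pow_eq_monomial,
    map_mul, pow_add]
  ring

theorem piMap_monomial (I J : Ideal R) (hJI : J ≤ I) {d : ℕ} (a : Fin d → R)
    (ha : ∀ i, a i ∈ J) (s : Fin d →₀ ℕ) {k : ℕ} {x : R} (hx : x ∈ I ^ k)
    (hx' : (∏ i, a i ^ s i) * x ∈ I ^ (s.degree + k))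
    (hy : homog I (s.degree + k) ((∏ i, a i ^ s i) * x) hx' ∈ Jt I J hJI ^ s.degree) :
    piMap I J hJI a ha (MvPolynomial.monomial s (Ideal.Quotient.mk _ (homog I k x hx))) =
      grHomog I J hJI s.degree (homog I (s.degree + k) ((∏ i, a i ^ s i) * x) hx') hy := by
  have haI : ∀ i, a i ∈ I ^ 1 := fun i => by simpa using hJI (ha i)
  have haJ : ∀ i, homog I 1 (a i) (haI i) ∈ Jt I J hJI ^ 1 := fun i =>
    homog_one_mem_Jt I J hJI (a i) (ha i)
  have h1 : homog (Jt I J hJI) s.degree _ hy =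
      homog (Jt I J hJI) 0 (homog I k x hx) (by simp) *
        ∏ i, homog (Jt I J hJI) 1 _ (haJ i) ^ s i := by
    have h2 := prod_homog_pow a haI s hx hx'
    have h3 : (∏ i, homog I 1 (a i) (haI i) ^ s i) * homog I k x hx ∈
        Jt I J hJI ^ (s.degree + 0) := by
      rw [mul_comm, h2]
      exact hy
    rw [prod_homog_pow _ haJ s _ h3]
    exact Subtype.ext (congrArg (monomial s.degree) (h2.symm.trans (mul_comm _ _)))
  have h4 : piMap I J hJI a ha (MvPolynomial.monomial s (Ideal.Quotient.mk _ (homog I k x hx))) =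
      toGr I J hJI (Ideal.Quotient.mk _ (homog I k x hx)) *
        ∏ i, grHomog I J hJI 1 (homog I 1 (a i) (haI i)) (haJ i) ^ s i := by
    rw [piMap, MvPolynomial.coe_eval₂Hom, MvPolynomial.eval₂_monomial,
      Finsupp.prod_fintype _ _ (by simp)]
  rw [h4, grHomog, h1, map_mul, map_prod]
  congr 1

end BigradedSally

/-- Multiplying by an element of the last power of the ideal that does not kill $f$ lands in the
socle. -/
theorem exists_smul_ne_zero_of_pow_smul_eq_zero {R X : Type*} [CommRing R] [AddCommGroup X]
    [Module R X] {𝔪 : Ideal R} {N : ℕ} {f : X} (hf : f ≠ 0) (h : ∀ r ∈ 𝔪 ^ N, r • f = 0) :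
    ∃ r : R, r • f ≠ 0 ∧ ∀ s ∈ 𝔪, s • r • f = 0 := by
  induction N with
  | zero =>
    exact absurd (one_smul R f ▸ h 1 (by simp)) hf
  | succ N ih =>
    by_cases h' : ∀ r ∈ 𝔪 ^ N, r • f = 0
    · exact ih h'
    · push Not at h'
      obtain ⟨r, hr, hne⟩ := h'
      refine ⟨r, hne, fun s hs => ?_⟩
      rw [smul_smul]
      exact h _ (by rw [pow_succ']; exact Ideal.mul_mem_mul hs hr)

namespace BigradedSally

variable {R : Type*} [CommRing R]

theorem map_piLin_cPiece (I J : Ideal R) (hJI : J ≤ I) {d : ℕ} (a : Fin d → R)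
    (ha : ∀ i, a i ∈ J) (hspan : J = Ideal.span (Set.range a)) (k n : ℕ) :
    (cPiece I J hJI d (n + k) n).map (piLin I J hJI a ha) = grPiece I J hJI (n + k) n := by
  have key : ∀ (s : Fin d →₀ ℕ), s.degree = n → ∀ x ∈ I ^ k,
      (∏ i, a i ^ s i) * x ∈ jtPiece I J n (n + k) := by
    rintro s rfl x hx
    rw [jtPiece_of_le I J (by omega), Nat.add_sub_cancel_left]
    refine Ideal.mul_mem_mul ?_ hx
    rw [Finsupp.degree_eq_sum, ← Finset.prod_pow_eq_pow_sum]
    exact Ideal.prod_mem_prod fun i _ => Ideal.pow_mem_pow (ha i) _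
  have key' : ∀ (s : Fin d →₀ ℕ) (hs : s.degree = n) (x : R) (hx : x ∈ I ^ k),
      grMap I J hJI (n + k) n ⟨(∏ i, a i ^ s i) * x, key s hs x hx⟩ = piLin I J hJI a ha
        (MvPolynomial.monomial s (Ideal.Quotient.mk (Jt I J hJI) (homog I k x hx))) := by
    rintro s rfl x hx
    exact (piMap_monomial I J hJI a ha s hx (jtPiece_le_pow hJI _ _ (key s rfl x hx))
      (homog_mem_Jt_pow hJI (key s rfl x hx) _)).symm
  apply le_antisymm
  · rw [cPiece, Submodule.map_span_le]
    rintro _ ⟨s, k', x, hx, hs, hk, rfl⟩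
    obtain rfl : k' = k := by omega
    rw [← range_grMap]
    exact ⟨_, key' s hs x hx⟩
  -- `T` collects the elements of $J^nI^k$ whose class is hit. It contains every monomial in the
  -- $a_i$ times an element of $I^k$, and by `map_evalHomog` sums of these exhaust $J^nI^k$.
  · let T : Submodule R R := (((cPiece I J hJI d (n + k) n).map (piLin I J hJI a ha)).comap
      (grMap I J hJI (n + k) n)).map (jtPiece I J n (n + k)).subtype
    have hT : jtPiece I J n (n + k) ≤ T := by
      rw [jtPiece_of_le I J (by omega), Nat.add_sub_cancel_left, mul_comm]
      conv_lhs => rw [hspan]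
      rw [← map_evalHomog]
      rintro _ ⟨c, hc, rfl⟩
      rw [evalHomog, Fintype.linearCombination_apply]
      refine Submodule.sum_mem _ fun s _ => ?_
      have hs := MonomialIndex.mem_iff.mp s.2
      refine ⟨⟨(∏ i, a i ^ s.1 i) * c s, key s.1 hs (c s) (hc s trivial)⟩, ?_, mul_comm _ _⟩
      exact ⟨_, Submodule.subset_span ⟨s.1, k, c s, hc s trivial, hs, add_comm _ _, rfl⟩,
        (key' s.1 hs (c s) (hc s trivial)).symm⟩
    rw [← range_grMap]
    rintro _ ⟨y, rfl⟩
    obtain ⟨z, hz, hzy⟩ := hT y.2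
    obtain rfl : z = y := Subtype.ext hzy
    exact hz

theorem length_cPiece_eq_add (I J : Ideal R) (hJI : J ≤ I) {d : ℕ} (a : Fin d → R)
    (ha : ∀ i, a i ∈ J) (hspan : J = Ideal.span (Set.range a)) {m n : ℕ} (h : n ≤ m) :
    Module.length R (cPiece I J hJI d m n) =
      Module.length R (cPiece I J hJI d m n ⊓ LinearMap.ker (piLin I J hJI a ha) :
        Submodule R (C I J hJI d)) + Module.length R (grPiece I J hJI m n) := by
  obtain ⟨k, rfl⟩ := Nat.exists_eq_add_of_le h
  rw [← map_piLin_cPiece I J hJI a ha hspan]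
  exact Module.length_eq_length_inf_ker_add_length_map _ _

theorem hilbertM_eq_add (I J : Ideal R) (hJI : J ≤ I) {d : ℕ} (a : Fin d → R)
    (ha : ∀ i, a i ∈ J) (hspan : J = Ideal.span (Set.range a)) {m n : ℕ} (h : m ≤ n) :
    hilbertM I J hJI d m n = hilbertK I J hJI a ha m n + hilbertSigma I J hJI m n := by
  have h1 : hilbertSigma I J hJI m n =
      ∑ j ∈ Finset.range m, Module.length R (grPiece I J hJI m j) := by
    rw [hilbertSigma_eq I J hJI h, ← jtPiece_zero I J m, ← jtPiece_self I J m,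
      ← sum_quotLength_eq (B := fun j => jtPiece I J j m) m fun j _ => jtPiece_succ_le hJI j m]
    exact Finset.sum_congr rfl fun j _ => (length_grPiece I J hJI m j).symm
  rw [hilbertM_eq I J hJI d h, hilbertK_eq I J hJI a ha h, h1, ← Finset.sum_add_distrib]
  exact Finset.sum_congr rfl fun j hj =>
    length_cPiece_eq_add I J hJI a ha hspan (Finset.mem_range.mp hj).le

theorem hilbertM_eq_sum (I J : Ideal R) (hJI : J ≤ I) {d : ℕ} (hd : 0 < d) {m n : ℕ}
    (h : m ≤ n) : hilbertM I J hJI d m n = ∑ p ∈ Finset.range m,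
      ((m - (p + 1) + (d - 1)).choose (d - 1) : ℕ) * quotLength (I ^ (p + 1)) (J * I ^ p) := by
  -- Substituting $j=m-1-p$ indexes the sum by the diagonal $p$.
  rw [hilbertM_eq I J hJI d h, ← Finset.sum_range_reflect]
  refine Finset.sum_congr rfl fun p hp => ?_
  have hp := Finset.mem_range.mp hp
  have := length_cPiece I J hJI d (p + 1) (m - 1 - p)
  rwa [show m - 1 - p + (p + 1) = m by omega, MonomialIndex.card hd, jtPiece_one_succ,
    show m - 1 - p + (d - 1) = m - (p + 1) + (d - 1) by omega] at this

theorem mMod_eq_bot {I J : Ideal R} (hJI : J ≤ I) (d : ℕ)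
    (h : ∀ p, quotLength (I ^ (p + 1)) (J * I ^ p) = 0) : mMod I J hJI d = ⊥ := by
  rw [mMod, diagPart, eq_bot_iff]
  refine iSup₂_le fun p n => ?_
  have h1 : Module.length R (cPiece I J hJI d (n + p + 1) n) = 0 := by
    rw [add_assoc, length_cPiece, jtPiece_one_succ, h, mul_zero]
  rw [Module.length_eq_zero_iff, Submodule.subsingleton_iff_eq_bot] at h1
  rw [h1, inf_bot_eq]

/-- Strictly off the diagonal the coefficients come from $I^{k+1}/JI^k$, and $J\cdot
I^{k+1}\subseteq JI^k$. On the diagonal they come from $R$ and nothing of the kind holds. -/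
theorem smul_eq_zero_of_mem_cPiece {I J : Ideal R} (hJI : J ≤ I) {d m n : ℕ} (h : n < m)
    {f : C I J hJI d} (hf : f ∈ cPiece I J hJI d m n) {c : R} (hc : c ∈ J) : c • f = 0 := by
  obtain ⟨k, rfl⟩ := Nat.exists_eq_add_of_lt h
  rw [add_assoc, cPiece_add] at hf
  obtain ⟨y, rfl⟩ := hf
  ext s
  obtain ⟨x, hx⟩ := coeff_polyMap_mem (reesQuotMap I J hJI (k + 1)) y s
  rw [MvPolynomial.coeff_smul, ← hx, ← map_smul, MvPolynomial.coeff_zero, reesQuotMap_eq_zero_iff,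
    jtPiece_one_succ]
  exact Ideal.mul_mem_mul hc (Ideal.pow_le_pow_right (Nat.le_succ k) x.2)

theorem polyMap_mul_mem_cPiece {I J : Ideal R} (hJI : J ≤ I) {d m n : ℕ} {f : C I J hJI d}
    (hf : f ∈ cPiece I J hJI d m n) {j : ℕ} (c : MonomialIndex d j → R) :
    polyMap d (Algebra.linearMap R (reesAlgebra I ⧸ Jt I J hJI)) j c * f ∈
      cPiece I J hJI d (m + j) (n + j) := by
  change homogPoly _ * f ∈ _
  rw [homogPoly, Finset.sum_mul]
  refine Submodule.sum_mem _ fun t _ => ?_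
  induction hf using Submodule.span_induction with
  | mem f hf =>
    obtain ⟨s, k, x, hx, hs, hk, rfl⟩ := hf
    refine Submodule.subset_span ⟨t.1 + s, k, c t • x, Submodule.smul_mem _ _ hx, ?_, by omega, ?_⟩
    · rw [map_add, hs, MonomialIndex.mem_iff.mp t.2, add_comm]
    · rw [MvPolynomial.monomial_mul]
      congr 1
      rw [homog_smul I k (c t) hx]
      exact (Algebra.smul_def (c t) (Ideal.Quotient.mk (Jt I J hJI) (homog I k x hx))).symm
  | zero => rw [mul_zero]; exact zero_mem _
  | add f g _ _ hf hg => rw [mul_add]; exact add_mem hf hg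
  | smul r f _ hf => rw [mul_smul_comm]; exact Submodule.smul_mem _ _ hf

/-- A nonzero homogeneous element of $K$ is killed by $J$, hence by a power of the maximal ideal, so
it has a nonzero socle multiple. Multiplying that by forms of degree $j$ stays in the kernel and
gives one dimension per monomial. -/
theorem exists_card_le_length_of_kMod_ne_bot [IsLocalRing R] {I J : Ideal R} (hJI : J ≤ I)
    {d : ℕ} (a : Fin d → R) (ha : ∀ i, a i ∈ J) {N : ℕ} (hN : IsLocalRing.maximalIdeal R ^ N ≤ J)
    (hK : kMod I J hJI a ha ≠ ⊥) : ∃ m n, n < m ∧ ∀ j, (Fintype.card (MonomialIndex d j) : ℕ∞) ≤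
      Module.length R (cPiece I J hJI d (m + j) (n + j) ⊓ LinearMap.ker (piLin I J hJI a ha) :
        Submodule R (C I J hJI d)) := by
  have h1 : ∃ p n, cPiece I J hJI d (n + p + 1) n ⊓ LinearMap.ker (piLin I J hJI a ha) ≠ ⊥ := by
    by_contra! h
    refine hK ?_
    change diagPart (cPiece I J hJI d) (LinearMap.ker (piLin I J hJI a ha)) = ⊥
    rw [diagPart, eq_bot_iff]
    refine iSup₂_le fun p n => ?_
    rw [inf_comm, h]
  obtain ⟨p, n, hne⟩ := h1
  obtain ⟨f, hf, hf0⟩ := Submodule.exists_mem_ne_zero_of_ne_bot hne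
  obtain ⟨r, hr0, hr⟩ := exists_smul_ne_zero_of_pow_smul_eq_zero hf0 (N := N)
    fun r hr => smul_eq_zero_of_mem_cPiece hJI (by omega) hf.1 (hN hr)
  have hrf := Submodule.smul_mem _ r hf
  refine ⟨n + p + 1, n, by omega, fun j => ?_⟩
  rw [← length_map_mul_of_maximalIdeal_smul (r • f) hr0 hr j]
  refine Module.length_mono ?_
  rintro _ ⟨c, rfl⟩
  refine ⟨polyMap_mul_mem_cPiece hJI hrf.1 c, ?_⟩
  exact Ideal.mul_mem_left (RingHom.ker (piMap I J hJI a ha)) _ hrf.2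

theorem exists_choose_le_hilbertK [IsLocalRing R] {I J : Ideal R} (hJI : J ≤ I)
    {d : ℕ} (hd : 0 < d) (a : Fin d → R) (ha : ∀ i, a i ∈ J) {N : ℕ}
    (hN : IsLocalRing.maximalIdeal R ^ N ≤ J) (hK : kMod I J hJI a ha ≠ ⊥) :
    ∃ c, ∀ m n, m + c ≤ n →
      ((m + (d - 1)).choose (d - 1) : ℕ) ≤ hilbertK I J hJI a ha (m + c) n := by
  obtain ⟨m₀, n₀, hlt, hle⟩ := exists_card_le_length_of_kMod_ne_bot hJI a ha hN hK
  refine ⟨m₀, fun m n h => ?_⟩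
  rw [hilbertK_eq I J hJI a ha h, ← MonomialIndex.card hd, add_comm m]
  exact (hle m).trans (Finset.single_le_sum (f := fun j => Module.length R
    (cPiece I J hJI d (m₀ + m) j ⊓ LinearMap.ker (piLin I J hJI a ha) :
      Submodule R (C I J hJI d))) (fun _ _ => zero_le) (Finset.mem_range.mpr (by omega)))

theorem hilbertK_eq_zero {I J : Ideal R} (hJI : J ≤ I) {d : ℕ} (a : Fin d → R)
    (ha : ∀ i, a i ∈ J) (hK : kMod I J hJI a ha = ⊥) (m n : ℕ) :
    hilbertK I J hJI a ha m n = 0 := by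
  have h0 : hilbertK I J hJI a ha m n = ∑ j ∈ Finset.range (n + 1), Module.length R
      (kMod I J hJI a ha ⊓ cPiece I J hJI d m j : Submodule R (C I J hJI d)) := rfl
  rw [h0, hK]
  exact Finset.sum_eq_zero fun j _ => by rw [bot_inf_eq, Module.length_bot]

end BigradedSally

/-! ### Cohen-Macaulayness of polynomial rings over Artinian rings -/

section monicSequences

open RingTheory.Sequence

theorem RingEquiv.isWeaklyRegular_map {R S : Type*} [CommRing R] [CommRing S] (e : R ≃+* S)
    {rs : List R} (h : IsWeaklyRegular R rs) : IsWeaklyRegular S (rs.map e) := by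
  refine (e.toAddEquiv.isWeaklyRegular_congr (List.forall₂_map_right_iff.mpr
    (List.forall₂_same.mpr fun r _ x => ?_))).mp h
  exact map_mul e r x

theorem RingTheory.Sequence.IsWeaklyRegular.of_flat_module {R M : Type*} [CommRing R]
    [AddCommGroup M] [Module R M] [Module.Flat R M] {rs : List R} (h : IsWeaklyRegular R rs) :
    IsWeaklyRegular M rs :=
  ((TensorProduct.rid R M).isWeaklyRegular_congr rs).mp h.isWeaklyRegular_lTensor

open Pointwise in
theorem Polynomial.Monic.flat_quotSMulTop {S : Type*} [CommRing S] {g : S[X]} (hg : g.Monic) :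
    Module.Flat S (QuotSMulTop g S[X]) := by
  have h : (Ideal.span {g} : Submodule S[X] S[X]) = g • (⊤ : Submodule S[X] S[X]) := by
    rw [← Submodule.ideal_span_singleton_smul, smul_eq_mul, Ideal.mul_top]
  have := hg.free_quotient
  exact Module.Flat.of_linearEquiv ((Submodule.quotEquivOfEq _ _ h).restrictScalars S).symm

/-- Over the ring $S$ in the other variables the first polynomial is monic, so it is regular with a
quotient free over $S$; flatness carries the regularity of the remaining sequence over to that
quotient. -/
theorem MvPolynomial.isWeaklyRegular_aeval_X_of_monic {B : Type*} [CommRing B] {d : ℕ}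
    (f : Fin d → B[X]) (hf : ∀ i, (f i).Monic) : IsWeaklyRegular (MvPolynomial (Fin d) B)
      (List.ofFn fun i => Polynomial.aeval (MvPolynomial.X i : MvPolynomial (Fin d) B) (f i)) := by
  induction d with
  | zero => simp
  | succ n ih =>
    let S := MvPolynomial (Fin n) B
    let g : S[X] := (f 0).map (algebraMap B S)
    have hg : g.Monic := (hf 0).map _
    have := hg.flat_quotSMulTop
    have h1 : IsWeaklyRegular S[X] (g :: (List.ofFn fun i : Fin n =>
        Polynomial.aeval (MvPolynomial.X i : S) (f i.succ)).map (algebraMap S S[X])) := by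
      refine IsWeaklyRegular.cons hg.isRegular.left.isSMulRegular ?_
      rw [isWeaklyRegular_map_algebraMap_iff]
      exact (ih _ fun i => hf i.succ).of_flat_module
    have key : ∀ i, Polynomial.aeval (MvPolynomial.X i : MvPolynomial (Fin (n + 1)) B) (f i) =
        (MvPolynomial.finSuccEquiv B n).symm
          (Polynomial.aeval (MvPolynomial.finSuccEquiv B n (MvPolynomial.X i)) (f i)) := fun i => by
      rw [← AlgEquiv.coe_toAlgHom, Polynomial.aeval_algHom_apply]
      simp
    suffices h2 : (List.ofFn fun i =>
        Polynomial.aeval (MvPolynomial.X i : MvPolynomial (Fin (n + 1)) B) (f i)) =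
        (g :: (List.ofFn fun i : Fin n => Polynomial.aeval (MvPolynomial.X i : S) (f i.succ)).map
          (algebraMap S S[X])).map (MvPolynomial.finSuccEquiv B n).symm.toRingEquiv by
      rw [h2]
      exact (MvPolynomial.finSuccEquiv B n).symm.toRingEquiv.isWeaklyRegular_map h1
    rw [List.ofFn_succ, List.map_cons, List.map_map, List.map_ofFn]
    congr 1
    · rw [key, MvPolynomial.finSuccEquiv_X_zero]
      exact congrArg (MvPolynomial.finSuccEquiv B n).symm (Polynomial.aeval_X_left_eq_map _)
    · refine congrArg List.ofFn ?_
      funext i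
      rw [key, MvPolynomial.finSuccEquiv_X_succ]
      refine congrArg (MvPolynomial.finSuccEquiv B n).symm ?_
      exact Polynomial.aeval_algebraMap_apply S[X] (MvPolynomial.X i : S) (f i.succ)

/-- The sequence localizes to a regular one, so each local ring has dimension at least $d$; the
global bound gives equality. -/
theorem IsCohenMacaulayRing.of_exists_isWeaklyRegular {S : Type*} [CommRing S] [IsNoetherianRing S]
    {d : ℕ} (hdim : ringKrullDim S ≤ d) (h : ∀ P : Ideal S, P.IsMaximal →
      ∃ rs : List S, rs.length = d ∧ (∀ r ∈ rs, r ∈ P) ∧ IsWeaklyRegular S rs) :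
    IsCohenMacaulayRing S := by
  refine ⟨inferInstance, fun P hP => ?_⟩
  obtain ⟨rs, hlen, hmem, hreg⟩ := h P hP
  have hP' : P.IsPrime := hP.isPrime
  have hreg' := hreg.isRegular_of_isLocalization_of_mem (Localization.AtPrime P) P hmem
  have hN : IsNoetherianRing (Localization.AtPrime P) :=
    IsLocalization.isNoetherianRing P.primeCompl _ inferInstance
  refine ⟨hN, rs.map (algebraMap S (Localization.AtPrime P)), ?_, hreg', ?_⟩
  · intro x hx
    obtain ⟨r, hr, rfl⟩ := List.mem_map.mp hx
    exact (IsLocalization.AtPrime.to_map_mem_maximal_iff _ P r).mpr (hmem r hr)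
  · rw [List.length_map, hlen]
    apply le_antisymm
    · rw [IsLocalization.AtPrime.ringKrullDim_eq_height P (Localization.AtPrime P)]
      exact (Ideal.height_le_ringKrullDim_of_ne_top hP.ne_top).trans hdim
    · rw [← ringKrullDim_add_length_eq_ringKrullDim_of_isRegular _ hreg', List.length_map, hlen]
      have : Nontrivial (Localization.AtPrime P ⧸
          Ideal.ofList (rs.map (algebraMap S (Localization.AtPrime P)))) := by
        rw [Ideal.Quotient.nontrivial_iff]
        intro h
        have := hreg'.top_ne_smul
        rw [h] at this
        simp at this
      exact le_add_of_nonneg_left ringKrullDim_nonneg_of_nontrivial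

/-- An Artinian ring is Jacobson, so the residue field at $P$ is integral over it. Each variable
thus satisfies a monic equation modulo $P$, and these equations form the sequence. -/
theorem MvPolynomial.exists_isWeaklyRegular_of_isArtinianRing {A : Type*} [CommRing A]
    [IsArtinianRing A] (d : ℕ) (P : Ideal (MvPolynomial (Fin d) A)) (hP : P.IsMaximal) :
    ∃ rs : List (MvPolynomial (Fin d) A), rs.length = d ∧ (∀ r ∈ rs, r ∈ P) ∧
      IsWeaklyRegular (MvPolynomial (Fin d) A) rs := by
  let _ : Field (MvPolynomial (Fin d) A ⧸ P) := Ideal.Quotient.field P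
  have hint := MvPolynomial.comp_C_integral_of_surjective_of_isJacobsonRing
    (Ideal.Quotient.mk P) Ideal.Quotient.mk_surjective
  choose f hf hf' using fun i => hint (Ideal.Quotient.mk P (MvPolynomial.X i))
  refine ⟨_, ?_, ?_, MvPolynomial.isWeaklyRegular_aeval_X_of_monic f hf⟩
  · simp
  · intro r hr
    obtain ⟨i, rfl⟩ := List.mem_ofFn.mp hr
    rw [← Ideal.Quotient.eq_zero_iff_mem, Polynomial.aeval_def, Polynomial.hom_eval₂]
    exact hf' i

theorem IsCohenMacaulayRing.of_ringEquiv_mvPolynomial {A S : Type*} [CommRing A] [CommRing S]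
    [IsArtinianRing A] {d : ℕ} (e : MvPolynomial (Fin d) A ≃+* S) : IsCohenMacaulayRing S := by
  have : IsNoetherianRing S := isNoetherianRing_of_ringEquiv _ e
  refine .of_exists_isWeaklyRegular (d := d) ?_ fun P hP => ?_
  · rw [← ringKrullDim_eq_of_ringEquiv e, MvPolynomial.ringKrullDim_of_isNoetherianRing,
      Nat.card_fin]
    have h : ringKrullDim A ≤ 0 := Ring.krullDimLE_iff.mp inferInstance
    simpa using add_le_add_left h (d : WithBot ℕ∞)
  · obtain ⟨rs, hlen, hmem, hreg⟩ := MvPolynomial.exists_isWeaklyRegular_of_isArtinianRing d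
      (P.comap (e : MvPolynomial (Fin d) A →+* S))
      (Ideal.comap_isMaximal_of_surjective _ e.surjective)
    refine ⟨rs.map e, by simpa using hlen, ?_, e.isWeaklyRegular_map hreg⟩
    intro r hr
    obtain ⟨x, hx, rfl⟩ := List.mem_map.mp hr
    exact hmem x hx

end monicSequences

/-! ### The associated graded ring of an ideal generated by a quasi-regular sequence -/

section AssocGr

variable {R : Type*} [CommRing R] {d : ℕ}

/-- The map `R[T_1, …, T_d] → ⨁ Jⁿ Uⁿ` with `T_i ↦ a_i U`. -/
noncomputable def reesPresentation (a : Fin d → R) {J : Ideal R} (ha : ∀ i, a i ∈ J) :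
    MvPolynomial (Fin d) R →ₐ[R] reesAlgebra J :=
  MvPolynomial.aeval fun i => BigradedSally.homog J 1 (a i) (by simpa using ha i)

theorem coeff_reesPresentation (a : Fin d → R) {J : Ideal R} (ha : ∀ i, a i ∈ J)
    (F : MvPolynomial (Fin d) R) (n : ℕ) : (reesPresentation a ha F).1.coeff n =
      MvPolynomial.eval a (MvPolynomial.homogeneousComponent n F) := by
  induction F using MvPolynomial.induction_on' with
  | monomial s c =>
    have haJ : ∀ i, a i ∈ J ^ 1 := fun i => by simpa using ha i
    have h1 : (∏ i, a i ^ s i) * c ∈ J ^ (s.degree + 0) := by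
      refine Ideal.mul_mem_right _ _ ?_
      rw [add_zero, Finsupp.degree_eq_sum, ← Finset.prod_pow_eq_pow_sum]
      exact Ideal.prod_mem_prod fun i _ => Ideal.pow_mem_pow (ha i) _
    have h2 : reesPresentation a ha (MvPolynomial.monomial s c) =
        BigradedSally.homog J (s.degree + 0) ((∏ i, a i ^ s i) * c) h1 := by
      rw [← BigradedSally.prod_homog_pow a haJ s (k := 0) (x := c) (by simp), reesPresentation,
        MvPolynomial.aeval_monomial, Finsupp.prod_fintype _ _ (by simp)]
      rfl
    rw [h2]
    change (monomial s.degree ((∏ i, a i ^ s i) * c)).coeff n = _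
    rw [coeff_monomial]
    split_ifs with h
    · rw [MvPolynomial.homogeneousComponent_of_mem
        ((MvPolynomial.mem_homogeneousSubmodule _ _).mpr
          (MvPolynomial.isHomogeneous_monomial c rfl)), if_pos h.symm, MvPolynomial.eval_monomial,
        Finsupp.prod_fintype _ _ (by simp), mul_comm]
    · rw [MvPolynomial.homogeneousComponent_of_mem
        ((MvPolynomial.mem_homogeneousSubmodule _ _).mpr
          (MvPolynomial.isHomogeneous_monomial c rfl)), if_neg (Ne.symm h), map_zero]
  | add F G hF hG =>
    rw [map_add, map_add, map_add, ← hF, ← hG]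
    exact coeff_add _ _ n

theorem reesPresentation_surjective (a : Fin d → R) {J : Ideal R} (ha : ∀ i, a i ∈ J)
    (hspan : J = Ideal.span (Set.range a)) : Function.Surjective (reesPresentation a ha) := by
  have h1 : reesAlgebra J ≤ ((reesAlgebra J).val.comp (reesPresentation a ha)).range := by
    refine (adjoin_monomial_eq_reesAlgebra J).ge.trans ?_
    rw [Algebra.adjoin_le_iff]
    suffices Submodule.map (monomial 1 : R →ₗ[R] R[X]) J ≤ Subalgebra.toSubmodule
      ((reesAlgebra J).val.comp (reesPresentation a ha)).range from this
    conv_lhs => rw [hspan]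
    rw [Ideal.span, Submodule.map_span_le]
    rintro _ ⟨i, rfl⟩
    refine ⟨MvPolynomial.X i, ?_⟩
    change (reesPresentation a ha (MvPolynomial.X i)).1 = _
    rw [reesPresentation, MvPolynomial.aeval_X]
    rfl
  intro y
  obtain ⟨F, hF⟩ := h1 y.2
  exact ⟨F, Subtype.ext hF⟩

/-- Degree by degree this is quasi-regularity: a form of degree $n$ dies when its value lies in
$J^{n+1}$, that is, when its coefficients lie in $J$. -/
theorem IsQuasiRegular.ker_reesPresentation {a : Fin d → R} (hq : IsQuasiRegular a) {J : Ideal R}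
    (ha : ∀ i, a i ∈ J) (hspan : J = Ideal.span (Set.range a)) :
    RingHom.ker ((Ideal.Quotient.mk (J.map (algebraMap R (reesAlgebra J)))).comp
      (reesPresentation a ha).toRingHom) = J.map MvPolynomial.C := by
  apply le_antisymm
  · intro F hF
    rw [MvPolynomial.mem_map_C_iff]
    intro s
    have h1 := coeff_mem_pow_of_mem_map (Ideal.Quotient.eq_zero_iff_mem.mp hF) s.degree
    change (reesPresentation a ha F).1.coeff _ ∈ _ at h1
    rw [coeff_reesPresentation] at h1
    rw [hspan] at h1 ⊢
    have h2 := hq s.degree _ (MvPolynomial.homogeneousComponent_isHomogeneous _ _) h1 s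
    rwa [MvPolynomial.coeff_homogeneousComponent, if_pos rfl] at h2
  · rw [Ideal.map_le_iff_le_comap]
    intro c hc
    refine Ideal.Quotient.eq_zero_iff_mem.mpr ?_
    change reesPresentation a ha (MvPolynomial.C c) ∈ _
    rw [reesPresentation, MvPolynomial.aeval_C]
    exact Ideal.mem_map_of_mem _ hc

theorem IsQuasiRegular.isCohenMacaulayRing_assocGr {a : Fin d → R} (hq : IsQuasiRegular a)
    {J : Ideal R} (ha : ∀ i, a i ∈ J) (hspan : J = Ideal.span (Set.range a))
    (hA : IsArtinianRing (R ⧸ J)) : IsCohenMacaulayRing (AssocGr J) := by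
  refine .of_ringEquiv_mvPolynomial
    (((MvPolynomial.quotientEquivQuotientMvPolynomial (σ := Fin d) J).toRingEquiv.trans
    (Ideal.quotEquivOfEq (hq.ker_reesPresentation ha hspan).symm)).trans
    (RingHom.quotientKerEquivOfSurjective ?_))
  exact Ideal.Quotient.mk_surjective.comp (reesPresentation_surjective a ha hspan)

end AssocGr

/-! ### Leading coefficients of Hilbert polynomials -/

theorem EventuallyPoly.shift_one {k : ℕ} {f : ℕ → ℤ} (hf : EventuallyPoly k f) :
    EventuallyPoly k fun n => f (n + 1) := by
  induction k generalizing f with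
  | zero =>
    obtain ⟨N, hN⟩ := hf
    exact ⟨N, fun n hn => hN (n + 1) (by omega)⟩
  | succ k ih => exact ih (f := fun n => f (n + 1) - f n) hf

theorem Polynomial.coeff_nonneg_of_eventually_eval_nonneg {q : ℚ[X]} {k N : ℕ}
    (hq : q.natDegree ≤ k) (h : ∀ n : ℕ, N ≤ n → 0 ≤ q.eval (n : ℚ)) : 0 ≤ q.coeff k := by
  by_contra! hlt
  have hk : q.natDegree = k := le_antisymm hq (le_natDegree_of_ne_zero hlt.ne)
  rcases Nat.eq_zero_or_pos k with rfl | hpos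
  · have := h N le_rfl
    rw [eq_C_of_natDegree_eq_zero hk, eval_C] at this
    exact this.not_gt hlt
  · have hdeg : 0 < q.degree := natDegree_pos_iff_degree_pos.mp (hk ▸ hpos)
    have hlead : q.leadingCoeff ≤ 0 := by rw [leadingCoeff, hk]; exact hlt.le
    have ht := (q.tendsto_atBot_of_leadingCoeff_nonpos hdeg hlead).comp
      (tendsto_natCast_atTop_atTop (R := ℚ))
    obtain ⟨n, hn, hnN⟩ := ((ht.eventually_lt_atBot 0).and
      (Filter.eventually_ge_atTop N)).exists
    exact (h n hnN).not_gt hn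

/-- The comparison polynomial has degree $k$ and leading coefficient $1/k!$, a lower bound for the
coefficient in question. -/
theorem Polynomial.coeff_pos_of_preHilbertPoly_le {p : ℚ[X]} {k c N : ℕ} (hp : p.natDegree ≤ k)
    (h : ∀ n : ℕ, N ≤ n → (preHilbertPoly ℚ k c).eval (n : ℚ) ≤ p.eval (n : ℚ)) :
    0 < p.coeff k := by
  have h1 : 0 ≤ (p - preHilbertPoly ℚ k c).coeff k := by
    refine coeff_nonneg_of_eventually_eval_nonneg (N := N)
      ((natDegree_sub_le_of_le hp (natDegree_preHilbertPoly ℚ k c).le).trans (max_self k).le) ?_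
    intro n hn
    rw [eval_sub, sub_nonneg]
    exact h n hn
  rw [coeff_sub, coeff_preHilbertPoly_self, sub_nonneg] at h1
  exact lt_of_lt_of_le (by positivity) h1

theorem Polynomial.eval_preHilbertPoly (j : ℕ) {s n : ℕ} (h : s ≤ n) :
    (preHilbertPoly ℚ j s).eval (n : ℚ) = ((n - s + j).choose j : ℕ) := by
  rw [preHilbertPoly_eq_choose_sub_add ℚ j h]

namespace BigradedSally

theorem multiplicity_zero : multiplicity 0 = 0 := by simp [multiplicity]

theorem degree_eq_and_multiplicity_eq {p : ℚ[X]} {k : ℕ} {c : ℚ} (hp : p.natDegree ≤ k)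
    (hc : p.coeff k = c * (k.factorial : ℚ)⁻¹) (h0 : p.coeff k ≠ 0) :
    p.degree = (k : WithBot ℕ) ∧ multiplicity p = c := by
  have hk : p.natDegree = k := le_antisymm hp (le_natDegree_of_ne_zero h0)
  refine ⟨degree_eq_of_le_of_coeff_ne_zero (natDegree_le_iff_degree_le.mp hp) h0, ?_⟩
  rw [multiplicity, leadingCoeff, hk, hc]
  field_simp

theorem IsHilbertPoly.coeff_pos {h : ℕ → ℕ → ℕ∞} {p : ℚ[X]} (hp : IsHilbertPoly h p) {k c : ℕ}
    (hdeg : p.natDegree ≤ k)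
    (hle : ∀ m n, m + c ≤ n → ((m + k).choose k : ℕ) ≤ h (m + c) n) : 0 < p.coeff k := by
  obtain ⟨m₀, n₀, hmn⟩ := hp
  refine Polynomial.coeff_pos_of_preHilbertPoly_le (c := c) (N := m₀ + c) hdeg fun m hm => ?_
  obtain ⟨m, rfl⟩ := Nat.exists_eq_add_of_le' (show c ≤ m by omega)
  obtain ⟨b, hb, hpb⟩ := hmn (m + c) (m + c + n₀) (by omega) le_rfl
  have h1 := hle m (m + c + n₀) (by omega)
  rw [hb, Nat.cast_le] at h1
  rw [Polynomial.eval_preHilbertPoly k (by omega), hpb, Nat.add_sub_cancel]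
  exact_mod_cast h1

theorem IsHilbertPoly.eq_zero {h : ℕ → ℕ → ℕ∞} {p : ℚ[X]} (hp : IsHilbertPoly h p)
    (h0 : ∀ m n, h m n = 0) : p = 0 := by
  obtain ⟨m₀, n₀, hmn⟩ := hp
  refine Polynomial.eq_zero_of_infinite_isRoot p ?_
  refine Set.Infinite.mono ?_ ((Set.Ici_infinite m₀).image (Nat.cast_injective (R := ℚ)).injOn)
  rintro _ ⟨m, hm, rfl⟩
  obtain ⟨b, hb, hpb⟩ := hmn m (m + n₀) hm le_rfl
  rw [h0] at hb
  have : b = 0 := by exact_mod_cast hb.symm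
  rw [Set.mem_ofPred_eq, IsRoot, hpb, this, Nat.cast_zero]

theorem IsHilbertPoly.sub_of_add_eq {f g h : ℕ → ℕ → ℕ∞} {p q : ℚ[X]} (hf : IsHilbertPoly f p)
    (hg : IsHilbertPoly g q) (hadd : ∀ m n, m ≤ n → f m n = h m n + g m n) :
    IsHilbertPoly h (p - q) := by
  obtain ⟨m₁, n₁, h1⟩ := hf
  obtain ⟨m₂, n₂, h2⟩ := hg
  refine ⟨max m₁ m₂, max n₁ n₂, fun m n hm hn => ?_⟩
  obtain ⟨a, ha, hpa⟩ := h1 m n (by omega) (by omega)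
  obtain ⟨b, hb, hqb⟩ := h2 m n (by omega) (by omega)
  have h3 := hadd m n (by omega)
  rw [ha, hb] at h3
  have hfin : h m n ≠ ⊤ := by
    intro h
    rw [h] at h3
    exact ENat.natCast_ne_top a (by simpa only [top_add] using h3)
  obtain ⟨c, hc⟩ := ENat.ne_top_iff_exists.mp hfin
  rw [← hc] at h3
  refine ⟨c, hc.symm, ?_⟩
  have h4 : a = c + b := by exact_mod_cast h3
  rw [eval_sub, hpa, hqb, h4]
  push_cast
  ring

end BigradedSally

/-! ### Reductions, quasi-regularity and Hilbert coefficients -/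

section CohenMacaulay

open IsLocalRing

variable {R : Type*} [CommRing R] [IsLocalRing R]

theorem IsReduction.exists_maximalIdeal_pow_le [IsNoetherianRing R] {I J : Ideal R}
    (hI : I.radical = maximalIdeal R) (h : IsReduction J I) : ∃ k, maximalIdeal R ^ k ≤ J := by
  obtain ⟨k, hk⟩ := Ideal.exists_radical_pow_le_of_fg I (IsNoetherian.noetherian _)
  obtain ⟨r, hr⟩ := h.2
  refine ⟨k * (r + 1), ?_⟩
  rw [pow_mul, ← hI]
  exact (Ideal.pow_right_mono hk _).trans (hr.le.trans Ideal.mul_le_left)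

/-- As many elements as the dimension, generating an ideal that contains a power of the maximal
ideal, form a system of parameters; maximal depth makes them a regular sequence. -/
theorem IsCohenMacaulayLocalRing.isQuasiRegular (hR : IsCohenMacaulayLocalRing R) {d : ℕ}
    (hdim : ringKrullDim R = (d : ℕ)) {a : Fin d → R} (hm : ∀ i, a i ∈ maximalIdeal R) {k : ℕ}
    (hk : maximalIdeal R ^ k ≤ Ideal.span (Set.range a)) : IsQuasiRegular a := by
  obtain ⟨hN, rs, hmem, hreg, hlen⟩ := hR
  refine isQuasiRegular_of_isWeaklyRegular a hm ?_
  refine isWeaklyRegular_of_maximalIdeal_le_radical (M := R) (List.ofFn a) ?_ ?_ rs ?_ hmem hreg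
  · intro r hr
    obtain ⟨i, rfl⟩ := List.mem_ofFn.mp hr
    exact hm i
  · have h1 : Ideal.span (Set.range a) ≤ Ideal.ofList (List.ofFn a) := by
      refine Ideal.span_le.mpr ?_
      rintro _ ⟨i, rfl⟩
      exact Ideal.subset_span (List.mem_ofFn.mpr ⟨i, rfl⟩)
    exact fun x hx => ⟨k, le_sup_left (α := Ideal R) (h1 (hk (Ideal.pow_mem_pow hx k)))⟩
  · rw [List.length_ofFn]
    rw [hdim] at hlen
    exact_mod_cast hlen.symm

end CohenMacaulay

theorem hilbertFun_one {R : Type*} [CommRing R] (I : Ideal R) (n : ℕ) :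
    hilbertFun I 1 n = quotLength ⊤ (I ^ (n + 1)) := by
  have h := sum_quotLength_eq (B := fun j => I ^ j) (n + 1)
    fun j _ => Ideal.pow_le_pow_right (Nat.le_succ j)
  simp only [pow_zero, Ideal.one_eq_top] at h
  exact h

section reduction

variable {R : Type*} [CommRing R] {I J : Ideal R}

theorem quotLength_pow_succ_mul_eq_zero {r : ℕ} (hr : I ^ (r + 1) = J * I ^ r) {p : ℕ}
    (hp : r ≤ p) : quotLength (I ^ (p + 1)) (J * I ^ p) = 0 := by
  obtain ⟨q, rfl⟩ := Nat.exists_eq_add_of_le hp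
  rw [show r + q + 1 = q + (r + 1) by ring, pow_add, hr, mul_left_comm, ← pow_add, add_comm q r]
  exact quotLength_self _

theorem lambdaInv_eq_sum {r : ℕ} (hr : I ^ (r + 1) = J * I ^ r) :
    lambdaInv I J = ∑ p ∈ Finset.range r, quotLength (I ^ (p + 1)) (J * I ^ p) := by
  refine le_antisymm (iSup_le fun N => ?_)
    (le_iSup (fun N => ∑ p ∈ Finset.range N, quotLength (I ^ (p + 1)) (J * I ^ p)) r)
  calc
    _ ≤ ∑ p ∈ Finset.range (max N r), quotLength (I ^ (p + 1)) (J * I ^ p) :=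
      Finset.sum_le_sum_of_subset (Finset.range_mono (le_max_left N r))
    _ = _ := (Finset.sum_subset (Finset.range_mono (le_max_right N r)) fun p _ hp =>
      quotLength_pow_succ_mul_eq_zero hr (by simpa using hp)).symm

/-- The Hilbert coefficients of `I` in terms of the length of `R / J` and of the expansion of the
length of `Iⁿ⁺¹ / Jⁿ⁺¹` in binomial coefficients. -/
theorem isHilbertCoeffs_of_eq_sum_choose {d : ℕ} (hd : 0 < d) {a : Fin d → R}
    (hq : IsQuasiRegular a) (hspan : J = Ideal.span (Set.range a)) (hJI : J ≤ I)
    (hfin : ∀ n, quotLength ⊤ (J ^ n) ≠ ⊤) {c : ℕ → ℤ} {N : ℕ}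
    (hc : ∀ n ≥ N, ((quotLength (I ^ (n + 1)) (J ^ (n + 1))).toNat : ℤ) =
      ∑ j ∈ Finset.range d, c j * ((n + j).choose j : ℤ)) :
    IsHilbertCoeffs I d fun j =>
      if j = 0 then ((quotLength ⊤ J).toNat : ℤ) else (-1) ^ (j + 1) * c (d - j) := by
  refine ⟨N, fun n hn => ?_⟩
  have h1 := quotLength_add (Ideal.pow_right_mono hJI (n + 1)) (le_top (a := I ^ (n + 1)))
  have h2 := hq.quotLength_top_pow hd (n + 1)
  rw [← hspan] at h2
  have h3 := hfin 1
  rw [pow_one] at h3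
  have h4 := hfin (n + 1)
  rw [h1, Ne, ENat.add_eq_top, not_or] at h4
  obtain ⟨b, hb⟩ := ENat.ne_top_iff_exists.mp h4.1
  obtain ⟨u, hu⟩ := ENat.ne_top_iff_exists.mp h4.2
  obtain ⟨l, hl⟩ := ENat.ne_top_iff_exists.mp h3
  have h5 := hc n hn
  rw [← hu, ENat.toNat_natCast] at h5
  rw [h2, ← hb, ← hu, ← hl] at h1
  have h6 : (n + 1 + (d - 1)).choose d * l = b + u := by exact_mod_cast h1
  have h7 : ((n + d).choose d : ℤ) * l = b + u := by
    rw [show n + d = n + 1 + (d - 1) by omega]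
    exact_mod_cast h6
  refine ⟨b, by rw [hilbertFun_one, hb], ?_⟩
  rw [Finset.sum_range_succ', ← hl, ENat.toNat_natCast]
  beta_reduce
  rw [if_pos rfl, pow_zero, one_mul,
    Nat.sub_zero, mul_comm (l : ℤ), h7, h5]
  -- The sign in $e_{j+1}$ is chosen so that the product of signs is $-1$: the length of
  -- $I^{n+1}/J^{n+1}$ is subtracted from that of $R/J^{n+1}$.
  have h8 : ∀ j ∈ Finset.range d, (-1 : ℤ) ^ (j + 1) *
      (if j + 1 = 0 then (l : ℤ) else (-1) ^ (j + 1 + 1) * c (d - (j + 1))) *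
      ((n + (d - (j + 1))).choose (d - (j + 1)) : ℤ) =
      -(c (d - 1 - j) * ((n + (d - 1 - j)).choose (d - 1 - j) : ℤ)) := fun j hj => by
    rw [if_neg (Nat.succ_ne_zero j), ← mul_assoc, ← pow_add, show d - (j + 1) = d - 1 - j by omega,
      show j + 1 + (j + 1 + 1) = 2 * (j + 1) + 1 by ring, pow_succ, pow_mul]
    simp
  rw [Finset.sum_congr rfl h8, Finset.sum_neg_distrib,
    Finset.sum_range_reflect (fun j => c j * ((n + j).choose j : ℤ)) d]
  ring

end reduction

/-! ### The Hilbert polynomials of ℳ and Σ -/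

namespace BigradedSally

variable {R : Type*} [CommRing R]

/-- The Hilbert polynomial of `ℳ`. -/
noncomputable def mPoly (I J : Ideal R) (k r : ℕ) : ℚ[X] :=
  ∑ p ∈ Finset.range r, ((quotLength (I ^ (p + 1)) (J * I ^ p)).toNat : ℚ) •
    preHilbertPoly ℚ k (p + 1)

theorem natDegree_mPoly_le (I J : Ideal R) (k r : ℕ) : (mPoly I J k r).natDegree ≤ k :=
  natDegree_sum_le_of_forall_le _ _ fun p _ =>
    (natDegree_smul_le _ _).trans (natDegree_preHilbertPoly ℚ k (p + 1)).le

theorem coeff_mPoly (I J : Ideal R) (k r : ℕ) : (mPoly I J k r).coeff k =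
    ((∑ p ∈ Finset.range r, (quotLength (I ^ (p + 1)) (J * I ^ p)).toNat : ℕ) : ℚ) *
      (k.factorial : ℚ)⁻¹ := by
  simp only [mPoly, finsetSum_coeff, coeff_smul, coeff_preHilbertPoly_self, smul_eq_mul,
    Nat.cast_sum, Finset.sum_mul]

theorem isHilbertPoly_mPoly {I J : Ideal R} (hJI : J ≤ I) {k r : ℕ}
    (hr : I ^ (r + 1) = J * I ^ r) (hfin : ∀ p, quotLength (I ^ (p + 1)) (J * I ^ p) ≠ ⊤) :
    IsHilbertPoly (hilbertM I J hJI (k + 1)) (mPoly I J k r) := by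
  -- From $m=r$ on, the terms with $p\ge r$ vanish, and $p+1\le m$ in the others keeps the
  -- subtraction in the binomial untruncated.
  refine ⟨r, 0, fun m n hm hn => ⟨∑ p ∈ Finset.range r, (m - (p + 1) + k).choose k *
    (quotLength (I ^ (p + 1)) (J * I ^ p)).toNat, ?_, ?_⟩⟩
  · rw [hilbertM_eq_sum I J hJI (d := k + 1) k.succ_pos (m := m) hn, Nat.add_sub_cancel, Nat.cast_sum,
      ← Finset.sum_subset (Finset.range_mono hm)]
    · exact Finset.sum_congr rfl fun p _ => by rw [Nat.cast_mul, ENat.natCast_toNat (hfin p)]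
    · intro p _ hp
      rw [quotLength_pow_succ_mul_eq_zero hr (by simpa using hp), mul_zero]
  · rw [mPoly, eval_finsetSum, Nat.cast_sum]
    refine Finset.sum_congr rfl fun p hp => ?_
    have := Finset.mem_range.mp hp
    rw [eval_smul, eval_preHilbertPoly k (by omega), smul_eq_mul, Nat.cast_mul, mul_comm]

/-- The polynomial in `m` that takes the values `∑ j, c j * binom(m - 1 + j, j)`. -/
noncomputable def chooseSumPoly (c : ℕ → ℤ) (k : ℕ) : ℚ[X] :=
  ∑ j ∈ Finset.range (k + 1), (c j : ℚ) • preHilbertPoly ℚ j 1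

theorem natDegree_chooseSumPoly_le (c : ℕ → ℤ) (k : ℕ) : (chooseSumPoly c k).natDegree ≤ k :=
  natDegree_sum_le_of_forall_le _ _ fun j hj =>
    (natDegree_smul_le _ _).trans
      ((natDegree_preHilbertPoly ℚ j 1).le.trans (Nat.lt_succ_iff.mp (Finset.mem_range.mp hj)))

theorem coeff_chooseSumPoly (c : ℕ → ℤ) (k : ℕ) :
    (chooseSumPoly c k).coeff k = (c k : ℚ) * (k.factorial : ℚ)⁻¹ := by
  rw [chooseSumPoly, Finset.sum_range_succ, coeff_add, finsetSum_coeff, Finset.sum_eq_zero,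
    zero_add, coeff_smul, coeff_preHilbertPoly_self, smul_eq_mul]
  intro j hj
  rw [coeff_smul, coeff_eq_zero_of_natDegree_lt, smul_zero]
  rw [natDegree_preHilbertPoly]
  exact Finset.mem_range.mp hj

theorem isHilbertPoly_chooseSumPoly {I J : Ideal R} (hJI : J ≤ I) {k : ℕ}
    (hfin : ∀ n, quotLength (I ^ n) (J ^ n) ≠ ⊤) {c : ℕ → ℤ} {N : ℕ}
    (hc : ∀ n ≥ N, ((quotLength (I ^ (n + 1)) (J ^ (n + 1))).toNat : ℤ) =
      ∑ j ∈ Finset.range (k + 1), c j * ((n + j).choose j : ℤ)) :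
    IsHilbertPoly (hilbertSigma I J hJI) (chooseSumPoly c k) := by
  refine ⟨N + 1, 0, fun m n hm hn => ⟨(quotLength (I ^ m) (J ^ m)).toNat, ?_, ?_⟩⟩
  · rw [hilbertSigma_eq I J hJI (m := m) hn, ENat.natCast_toNat (hfin m)]
  · obtain ⟨m, rfl⟩ := Nat.exists_eq_add_of_le' (show 1 ≤ m by omega)
    have h1 := congrArg (Int.cast : ℤ → ℚ) (hc m (by omega))
    rw [Int.cast_natCast] at h1
    rw [h1, chooseSumPoly, eval_finsetSum, Int.cast_sum]
    refine Finset.sum_congr rfl fun j _ => ?_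
    rw [eval_smul, eval_preHilbertPoly j (by omega), Nat.add_sub_cancel, smul_eq_mul,
      Int.cast_mul, Int.cast_natCast]

/-- Inside $I^{m+1}/J^{m+1}$ sits $IJ^m/J^{m+1}$, one copy of $I/J\ne0$ for each monomial of degree
$m$. -/
theorem choose_le_hilbertSigma {I J : Ideal R} (hJI : J ≤ I) (hne : I ≠ J) {k : ℕ}
    {a : Fin (k + 1) → R} (hq : IsQuasiRegular a) (hspan : J = Ideal.span (Set.range a))
    {m n : ℕ} (h : m + 1 ≤ n) : ((m + k).choose k : ℕ) ≤ hilbertSigma I J hJI (m + 1) n := by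
  have h1 := hq.quotLength_mul_pow m (K := I)
  rw [← hspan, MonomialIndex.card k.succ_pos, Nat.succ_sub_one] at h1
  have h2 : I * J ^ m ≤ I ^ (m + 1) := by
    rw [pow_succ']
    exact Ideal.mul_mono_right (Ideal.pow_right_mono hJI m)
  have h3 : J ^ (m + 1) ≤ I * J ^ m := by
    rw [pow_succ']
    exact Ideal.mul_mono_left hJI
  have h4 : 1 ≤ quotLength I J := by
    rw [Order.one_le_iff_ne_zero, Ne, quotLength_eq_zero_iff]
    exact fun h => hne (le_antisymm h hJI)
  rw [hilbertSigma_eq I J hJI h]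
  refine le_trans ?_ (quotLength_mono_left h3 h2)
  rw [h1]
  exact le_mul_of_one_le_right (zero_le) h4

end BigradedSally

/-! ### Assembly -/

theorem mainTheorem4 {R : Type*} [CommRing R] [IsLocalRing R]
    (hR : IsCohenMacaulayLocalRing R) (d : ℕ) (hd : 0 < d) (hdim : ringKrullDim R = (d : ℕ))
    (I J : Ideal R) (hI : I.radical = IsLocalRing.maximalIdeal R)
    (hJ : IsMinimalReduction J I) (hJI : J ≤ I)
    (a : Fin d → R) (haJ : ∀ i, a i ∈ J) (hspan : J = Ideal.span (Set.range a)) :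
    ∃ (e : ℕ → ℤ) (L : ℕ) (pM pS pK : Polynomial ℚ),
      IsHilbertCoeffs I d e ∧
      lambdaInv I J = (L : ℕ∞) ∧
      BigradedSally.IsHilbertPoly (BigradedSally.hilbertM I J hJI d) pM ∧
      BigradedSally.IsHilbertPoly (BigradedSally.hilbertSigma I J hJI) pS ∧
      BigradedSally.IsHilbertPoly (BigradedSally.hilbertK I J hJI a haJ) pK ∧
      -- the module `ℳ`
      (BigradedSally.mMod I J hJI d ≠ ⊥ → pM.degree = ((d - 1 : ℕ) : WithBot ℕ)) ∧
      BigradedSally.multiplicity pM = (L : ℚ) ∧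
      -- the module `Σ`
      (BigradedSally.sigmaMod I J hJI = ⊥ → IsCohenMacaulayRing (AssocGr I)) ∧
      (BigradedSally.sigmaMod I J hJI ≠ ⊥ →
        pS.degree = ((d - 1 : ℕ) : WithBot ℕ) ∧ BigradedSally.multiplicity pS = (e 1 : ℚ)) ∧
      -- the module `K`, with `δ(I, J) = Λ(I, J) - e_1(I)`
      BigradedSally.multiplicity pK = (((L : ℤ) - e 1 : ℤ) : ℚ) ∧
      (BigradedSally.kMod I J hJI a haJ ≠ ⊥ → pK.degree = ((d - 1 : ℕ) : WithBot ℕ)) ∧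
      e 1 ≤ (L : ℤ) := by
  have hN : IsNoetherianRing R := hR.1
  obtain ⟨t, ht⟩ := hJ.1.exists_maximalIdeal_pow_le hI
  obtain ⟨r, hr⟩ := hJ.1.2
  obtain ⟨k, rfl⟩ := Nat.exists_eq_add_of_le' hd
  have hq : IsQuasiRegular a := hR.isQuasiRegular hdim
    (fun i => hI ▸ Ideal.le_radical (hJI (haJ i))) (hspan ▸ ht)
  have hpow : ∀ n, IsLocalRing.maximalIdeal R ^ (t * n) ≤ J ^ n := fun n => by
    rw [pow_mul]
    exact Ideal.pow_right_mono ht n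
  have hfinJ : ∀ n, quotLength ⊤ (J ^ n) ≠ ⊤ := fun n => quotLength_top_ne_top (hpow n)
  have hfinIJ : ∀ n, quotLength (I ^ n) (J ^ n) ≠ ⊤ := fun n =>
    ne_top_of_le_ne_top (hfinJ n) (quotLength_mono_left (Ideal.pow_right_mono hJI n) le_top)
  have hfinL : ∀ p, quotLength (I ^ (p + 1)) (J * I ^ p) ≠ ⊤ := fun p => by
    refine ne_top_of_le_ne_top (hfinIJ (p + 1)) (quotLength_mono_right ?_ ?_)
    · rw [pow_succ']
      exact Ideal.mul_mono_right (Ideal.pow_right_mono hJI p)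
    · rw [pow_succ']
      exact Ideal.mul_mono_left hJI
  obtain ⟨c, N, hc⟩ :=
    (eventuallyPoly_quotLength_pow hJI haJ hspan hr hfinIJ).shift_one.exists_eq_sum_choose
  set L := ∑ p ∈ Finset.range r, (quotLength (I ^ (p + 1)) (J * I ^ p)).toNat with hL
  have hL0 : L = 0 → ∀ p, quotLength (I ^ (p + 1)) (J * I ^ p) = 0 := fun h p => by
    rcases lt_or_ge p r with hp | hp
    · have := (Finset.sum_eq_zero_iff.mp (hL ▸ h)) p (Finset.mem_range.mpr hp)
      exact ((ENat.toNat_eq_zero).mp this).resolve_right (hfinL p)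
    · exact quotLength_pow_succ_mul_eq_zero hr hp
  have hM := BigradedSally.isHilbertPoly_mPoly hJI (k := k) hr hfinL
  have hS := BigradedSally.isHilbertPoly_chooseSumPoly hJI hfinIJ hc
  have hK := hM.sub_of_add_eq hS (h := BigradedSally.hilbertK I J hJI a haJ)
    fun m n h => BigradedSally.hilbertM_eq_add I J hJI a haJ hspan h
  have hcM := BigradedSally.coeff_mPoly I J k r
  have hcS := BigradedSally.coeff_chooseSumPoly c k
  have hcK : (BigradedSally.mPoly I J k r - BigradedSally.chooseSumPoly c k).coeff k =
      (((L : ℤ) - c k : ℤ) : ℚ) * (k.factorial : ℚ)⁻¹ := by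
    rw [coeff_sub, hcM, hcS, ← sub_mul, Int.cast_sub, Int.cast_natCast]
  have hdK := (natDegree_sub_le_of_le (BigradedSally.natDegree_mPoly_le I J k r)
    (BigradedSally.natDegree_chooseSumPoly_le c k)).trans (max_self k).le
  have hfact : (0 : ℚ) < (k.factorial : ℚ)⁻¹ := by positivity
  have hKmult : BigradedSally.multiplicity
      (BigradedSally.mPoly I J k r - BigradedSally.chooseSumPoly c k) =
        (((L : ℤ) - c k : ℤ) : ℚ) ∧ c k ≤ L ∧ (BigradedSally.kMod I J hJI a haJ ≠ ⊥ →
      (BigradedSally.mPoly I J k r - BigradedSally.chooseSumPoly c k).degree =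
        (k : WithBot ℕ)) := by
    -- If $K=0$, its polynomial vanishes and the top coefficient gives $\Lambda=e_1$. Otherwise the
    -- socle bound makes that coefficient positive, giving at once the degree, the multiplicity and
    -- $\Lambda>e_1$.
    by_cases h : BigradedSally.kMod I J hJI a haJ = ⊥
    · have h0 := hK.eq_zero (BigradedSally.hilbertK_eq_zero hJI a haJ h)
      have h1 : (L : ℤ) - c k = 0 := by
        rw [h0, coeff_zero, eq_comm, mul_eq_zero, or_iff_left hfact.ne'] at hcK
        exact_mod_cast hcK
      refine ⟨?_, by omega, fun h' => absurd h h'⟩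
      rw [h0, h1, BigradedSally.multiplicity_zero, Int.cast_zero]
    · obtain ⟨s, hs⟩ := BigradedSally.exists_choose_le_hilbertK hJI hd a haJ ht h
      have hpos := hK.coeff_pos hdK hs
      obtain ⟨h1, h2⟩ := BigradedSally.degree_eq_and_multiplicity_eq hdK hcK hpos.ne'
      refine ⟨h2, ?_, fun _ => h1⟩
      rw [hcK] at hpos
      have h3 : (0 : ℤ) < (L : ℤ) - c k := by
        exact_mod_cast (pos_iff_pos_of_mul_pos hpos).mpr hfact
      omega
  have he : (if 1 = 0 then ((quotLength ⊤ J).toNat : ℤ) else (-1) ^ (1 + 1) * c (k + 1 - 1)) =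
      c k := by simp
  refine ⟨_, L, _, _, _, isHilbertCoeffs_of_eq_sum_choose hd hq hspan hJI hfinJ hc, ?_, hM, hS, hK,
    ?_, ?_, ?_, ?_, ?_, hKmult.2.2, ?_⟩
  · rw [lambdaInv_eq_sum hr, hL, Nat.cast_sum]
    exact Finset.sum_congr rfl fun p _ => (ENat.natCast_toNat (hfinL p)).symm
  · intro h
    refine (BigradedSally.degree_eq_and_multiplicity_eq
      (BigradedSally.natDegree_mPoly_le I J k r) hcM ?_).1
    rw [hcM]
    refine mul_ne_zero (Nat.cast_ne_zero.mpr fun h0 => h ?_) hfact.ne'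
    exact BigradedSally.mMod_eq_bot hJI (k + 1) (hL0 h0)
  -- With $\Lambda=0$ the polynomial is zero and the multiplicity is the conventional $0$; otherwise
  -- the coefficient in degree $d-1$ is nonzero and is the leading one.
  · by_cases h : L = 0
    · have h0 : BigradedSally.mPoly I J k r = 0 := Finset.sum_eq_zero fun p _ => by
        rw [hL0 h p, ENat.toNat_zero, Nat.cast_zero, zero_smul]
      rw [h0, h, BigradedSally.multiplicity_zero, Nat.cast_zero]
    · refine (BigradedSally.degree_eq_and_multiplicity_eq
        (BigradedSally.natDegree_mPoly_le I J k r) hcM ?_).2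
      rw [hcM]
      exact mul_ne_zero (Nat.cast_ne_zero.mpr h) hfact.ne'
  · intro h
    rw [BigradedSally.sigmaMod_eq_bot_iff] at h
    rw [h]
    exact hq.isCohenMacaulayRing_assocGr haJ hspan
      (isArtinianRing_quotient_of_maximalIdeal_pow_le ht)
  · intro h
    rw [Ne, BigradedSally.sigmaMod_eq_bot_iff] at h
    have hpos := hS.coeff_pos (BigradedSally.natDegree_chooseSumPoly_le c k)
      fun m n hmn => BigradedSally.choose_le_hilbertSigma hJI h hq hspan hmn
    rw [he]
    exact BigradedSally.degree_eq_and_multiplicity_eq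
      (BigradedSally.natDegree_chooseSumPoly_le c k) hcS hpos.ne'
  · rw [he]
    exact hKmult.1
  · rw [he]
    exact hKmult.2.1
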